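/- Let $f:\mathbb R\to\mathbb R$ be $C^\infty$, let $c\in\mathbb R$, and let $\hat u\in C^2(\mathbb R)$ be the profile of a travelling wave $u(x,t)=\hat u(x-ct)$ of $u_t=u_{xx}+f(u)$, i.e. $\hat u''+c\hat u'+f(\hat u)=0$, with limits $\hat u_\pm=\lim_{\xi\to\pm\infty}\hat u(\xi)$. Put $\phi(\xi)=f'(\hat u(\xi))$ and assume that $\phi$ tends to its limits exponentially fast: for some $\alpha>0$, $\phi(\xi)-f'(\hat u_-)=O(e^{\alpha\xi})$ as $\xi\to-\infty$ and $\phi(\xi)-f'(\hat u_+)=O(e^{-\alpha\xi})$ as $\xi\to+\infty$. For $\lambda\in\mathbb C$ let $$A(\xi;\lambda)=\begin{bmatrix}0&1\\ \lambda-\phi(\xi)&-c\end{bmatrix},\qquad \kappa_\pm=\sqrt{c^2+4(\lambda-f'(\hat u_\pm))},\qquad \mu_\pm^{[1]}=\tfrac12(-c+\kappa_\pm),\qquad \mu_\pm^{[2]}=\tfrac12(-c-\kappa_\pm),$$ with the principal square root. Let $y_-$ and $y_+$ be the solutions of $y'=A(\xi;\lambda)y$ on $\mathbb R$ with $y_-(\xi)\sim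 e^{\mu_-^{[1]}\xi}(1,\mu_-^{[1]})^\top$ as $\xi\to-\infty$ and $y_+(\xi)\sim e^{\mu_+^{[2]}\xi}(1,\mu_+^{[2]})^\top$ as $\xi\to+\infty$, that is, $e^{-\mu_-^{[1]}\xi}y_-(\xi)\to(1,\mu_-^{[1]})^\top$ and $e^{-\mu_+^{[2]}\xi}y_+(\xi)\to(1,\mu_+^{[2]})^\top$. The Evans function is $D(\lambda)=\det[\,y_-(0)\mid y_+(0)\,]$. For $h>0$, $N\in\mathbb N$ and $L=Nh$, let $D_{\mathrm{num}}(\lambda)=\det[\,y_N^-\mid y_N^+\,]$ be the value computed with the exponential midpoint rule (second-order Magnus method) on $[-L,0]$ and $[0,L]$: $$y^-_0=y_-(-L),\quad y^-_{k+1}=\exp\bigl(hA(-L+kh+\tfrac12h;\lambda)\bigr)y^-_k,\qquad y^+_0=y_+(L),\quad y^+_{k+1}=\exp\bigl(-hA(L-kh-\tfrac12h;\lambda)\bigr)y^+_k .$$ Fix $\varepsilon>0$ and $K>0$. Then there is $R>0$, depending only on $f,c,\hat u,\varepsilon,K$, such that the following holds for all $\lambda$ with $|\lambda|\ge R$ and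 $|\arg\kappa_\pm|<\frac\pi2-\varepsilon$, and, in 1--3, for all $h>0$ with $|\kappa_\pm|\ge K/h$ and all $N$ (with $L=Nh$), where the constants $C,C_m,\beta_m$ do not depend on $\lambda,h,N$. 0. The solutions $y_-$ and $y_+$ exist and are unique. 1. The error in the Evans function is the midpoint-rule quadrature error of $\int_{-L}^L\phi$ plus $O(\lambda^{-1/2}h^2)$: $$\Bigl|\,D_{\mathrm{num}}(\lambda)-D(\lambda)-\Bigl(h\sum_{j=-N}^{N-1}\phi(jh+\tfrac12h)-\int_{-L}^{L}\phi(x)\,dx\Bigr)\Bigr|\le C\,|\lambda|^{-1/2}h^2 .$$ 2. For every integer $m\ge0$ there are $C_m$ and $\beta_m>0$ with $$|D_{\mathrm{num}}(\lambda)-D(\lambda)|\le C_m\bigl(h^2e^{-\beta_mL}+h^{2m+2}+|\lambda|^{-1/2}h^2\bigr).$$ 3. Consequently, for $L$ large the error is of order $\lambda^{-1/2}h^2$ as soon as some power of $h$ is dominated by $|\lambda|^{-1/2}$: for every integer $m\ge0$ there is $C_m$ such that for each $\lambda$ there is $L_0=L_0(\lambda)$ with $$|D_{\mathrm{num}}(\lambda)-D(\lambda)|\le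 C_m|\lambda|^{-1/2}h^2\qquad\text{whenever } L\ge L_0 \text{ and } h^{2m}\le|\lambda|^{-1/2}.$$ -/

import Mathlib

open Filter Topology Asymptotics
open scoped ContDiff

noncomputable section

/-- `uh` is the profile of a travelling wave `u(x,t) = uh (x - c t)` of `u_t = u_xx + f(u)`
(that is, `uh'' + c uh' + f(uh) = 0`), with limits `um` at `-∞` and `up` at `+∞`. -/
structure IsTravellingWave (f : ℝ → ℝ) (c um up : ℝ) (uh : ℝ → ℝ) : Prop where
  contDiff : ContDiff ℝ 2 uh
  ode : ∀ ξ, deriv (deriv uh) ξ + c * deriv uh ξ + f (uh ξ) = 0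
  tendsto_left : Tendsto uh atBot (𝓝 um)
  tendsto_right : Tendsto uh atTop (𝓝 up)

/-- The potential `φ(ξ) = f'(uh(ξ))`. -/
def wavePotential (f uh : ℝ → ℝ) (ξ : ℝ) : ℝ := deriv f (uh ξ)

/-- The coefficient matrix `A(ξ; lam)` of the eigenvalue problem `y' = A(ξ; lam) y`. -/
def evansMatrix (f : ℝ → ℝ) (c : ℝ) (uh : ℝ → ℝ) (lam : ℂ) (ξ : ℝ) :
    Matrix (Fin 2) (Fin 2) ℂ :=
  !![0, 1; lam - ((wavePotential f uh ξ : ℝ) : ℂ), -(c : ℂ)]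

/-- `κ = √(c² + 4 (lam - f'(u₀)))` (principal square root), for a rest state `u₀`. -/
def evansKappa (f : ℝ → ℝ) (c u₀ : ℝ) (lam : ℂ) : ℂ :=
  ((c : ℂ) ^ 2 + 4 * (lam - ((deriv f u₀ : ℝ) : ℂ))) ^ (1 / 2 : ℂ)

/-- The eigenvalue `μ^[1] = (-c + κ) / 2` of the limit matrix at the rest state `u₀`. -/
def evansMu₁ (f : ℝ → ℝ) (c u₀ : ℝ) (lam : ℂ) : ℂ :=
  (-(c : ℂ) + evansKappa f c u₀ lam) / 2

/-- The eigenvalue `μ^[2] = (-c - κ) / 2` of the limit matrix at the rest state `u₀`. -/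
def evansMu₂ (f : ℝ → ℝ) (c u₀ : ℝ) (lam : ℂ) : ℂ :=
  (-(c : ℂ) - evansKappa f c u₀ lam) / 2

/-- `y` solves the linear system `y' = A(ξ; lam) y` on the whole line. -/
def IsEvansSolution (f : ℝ → ℝ) (c : ℝ) (uh : ℝ → ℝ) (lam : ℂ) (y : ℝ → Fin 2 → ℂ) : Prop :=
  ∀ ξ, HasDerivAt y ((evansMatrix f c uh lam ξ).mulVec (y ξ)) ξ

/-- `y` is the solution `y₋`:  `y(ξ) ∼ exp(μ₋^[1] ξ) (1, μ₋^[1])ᵀ` as `ξ → -∞`. -/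
def IsLeftEvansSolution (f : ℝ → ℝ) (c um : ℝ) (uh : ℝ → ℝ) (lam : ℂ)
    (y : ℝ → Fin 2 → ℂ) : Prop :=
  IsEvansSolution f c uh lam y ∧
    Tendsto (fun ξ : ℝ => Complex.exp (-(evansMu₁ f c um lam * (ξ : ℂ))) • y ξ) atBot
      (𝓝 ![1, evansMu₁ f c um lam])

/-- `y` is the solution `y₊`:  `y(ξ) ∼ exp(μ₊^[2] ξ) (1, μ₊^[2])ᵀ` as `ξ → +∞`. -/
def IsRightEvansSolution (f : ℝ → ℝ) (c up : ℝ) (uh : ℝ → ℝ) (lam : ℂ)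
    (y : ℝ → Fin 2 → ℂ) : Prop :=
  IsEvansSolution f c uh lam y ∧
    Tendsto (fun ξ : ℝ => Complex.exp (-(evansMu₂ f c up lam * (ξ : ℂ))) • y ξ) atTop
      (𝓝 ![1, evansMu₂ f c up lam])

/-- The solution `y₋` (chosen; meaningful where it exists uniquely). -/
def evansLeft (f : ℝ → ℝ) (c um : ℝ) (uh : ℝ → ℝ) (lam : ℂ) : ℝ → Fin 2 → ℂ :=
  Classical.epsilon (IsLeftEvansSolution f c um uh lam)

/-- The solution `y₊` (chosen; meaningful where it exists uniquely). -/
def evansRight (f : ℝ → ℝ) (c up : ℝ) (uh : ℝ → ℝ) (lam : ℂ) : ℝ → Fin 2 → ℂ :=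
  Classical.epsilon (IsRightEvansSolution f c up uh lam)

/-- The wedge product `v ∧ w = det [v | w]` of two plane vectors. -/
def wedge (v w : Fin 2 → ℂ) : ℂ := (!![v 0, w 0; v 1, w 1]).det

/-- The Evans function `D(lam) = det [y₋(0) | y₊(0)]`. -/
def evansFunction (f : ℝ → ℝ) (c um up : ℝ) (uh : ℝ → ℝ) (lam : ℂ) : ℂ :=
  wedge (evansLeft f c um uh lam 0) (evansRight f c up uh lam 0)

/-- The exponential midpoint rule for `y' = A(ξ) y` with (signed) step `h`, started from the
value `y₀` at `ξ₀`:  `y_{k+1} = exp(h A(ξ_k + h/2)) y_k`, where `ξ_k = ξ₀ + k h`. -/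
def expMidpoint (A : ℝ → Matrix (Fin 2) (Fin 2) ℂ) (h ξ₀ : ℝ) (y₀ : Fin 2 → ℂ) :
    ℕ → Fin 2 → ℂ
  | 0 => y₀
  | k + 1 =>
      (NormedSpace.exp ((h : ℂ) • A (ξ₀ + k * h + h / 2))).mulVec (expMidpoint A h ξ₀ y₀ k)

/-- The numerically computed Evans function: `N` steps of the exponential midpoint rule with
step `h` from `-L` to `0` and `N` steps backwards (step `-h`) from `L` to `0`, where `L = N h`,
started from the exact values `y₋(-L)` and `y₊(L)`. -/
def evansNumerical (f : ℝ → ℝ) (c um up : ℝ) (uh : ℝ → ℝ) (lam : ℂ) (h : ℝ) (N : ℕ) : ℂ :=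
  wedge
    (expMidpoint (evansMatrix f c uh lam) h (-(N * h)) (evansLeft f c um uh lam (-(N * h))) N)
    (expMidpoint (evansMatrix f c uh lam) (-h) (N * h) (evansRight f c up uh lam (N * h)) N)

/-- The quadrature error of the midpoint rule with step `h` for `∫_{-L}^{L} φ`, `L = N h`. -/
def midpointQuadError (φ : ℝ → ℝ) (h : ℝ) (N : ℕ) : ℝ :=
  h * ∑ j ∈ Finset.Ico (-(N : ℤ)) (N : ℤ), φ ((j : ℝ) * h + h / 2)
    - ∫ x in (-(N * h))..(N * h), φ x

/-- `lam` is such that `κ₋` and `κ₊` lie in the sector `|arg κ| < π/2 - ε`. -/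
def InEvansSector (f : ℝ → ℝ) (c um up ε : ℝ) (lam : ℂ) : Prop :=
  |(evansKappa f c um lam).arg| < Real.pi / 2 - ε ∧
    |(evansKappa f c up lam).arg| < Real.pi / 2 - ε

/-- The step size satisfies `|κ₋| ≥ K / h` and `|κ₊| ≥ K / h`. -/
def StepNotSmall (f : ℝ → ℝ) (c um up K : ℝ) (lam : ℂ) (h : ℝ) : Prop :=
  K ≤ h * ‖evansKappa f c um lam‖ ∧ K ≤ h * ‖evansKappa f c up lam‖

end

/-! The exponential midpoint rule is exact for the system in which `φ` is replaced on `[-L, L]` by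
its midpoint value on each cell. Let `φs` be this step potential and `z` the solution for `φs`
normalised at `+∞` like `y₊`; then `z = y₊` on `[L, ∞)`. The backward steps from `L` reproduce `z`
at the nodes, and the forward steps change the Wronskian with `z` only by Abel's factor. So, with
`W(x) = exp (c x) det [y₋(x) | z(x)]`, one has `D_num = W(-L)`, while `D = W(L)` because the
weighted Wronskian of the exact solutions is constant. Lagrange's identity for the two potentials
then gives the exact formula `D_num - D = ∫_{-L}^{L} (φs - φ) p`, where `p` is `exp (c x)` times the
product of the first components of `y₋` and `z` (`exists_evansProduct`).

The quadrature error is `∫ (φs - φ)`, so part 1 is an estimate of `∫ (φs - φ) (p - 1)`. The midpoint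
defect integrated against a function of size `G` with derivative of size `G` is `O(G h ^ 2)`
(`norm_integral_stepPotential_sub_mul_le`), and it remains to show that `p - 1` and `p'` are `O(1 /
Re κ)`. The logarithmic derivatives of the solutions are `μ + δ`, where `δ` is the small bounded
solution of a Riccati equation, of size `O(1 / Re κ)` (`exists_isRiccati`). This bounds `p' / p`,
but integrating that bound would lose a factor `L`. Instead one writes `p d = W`, where `d` is large
and nearly constant and `W` varies little, since `∫ |φs - φ|` is bounded uniformly in `h` and `L`
(`norm_sub_one_le_of_mul_variation`). In the sector `Re κ ≥ sin ε |κ| ≥ sin ε |lam| ^ (1 / 2)` for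
large `lam`.

Part 2 bounds the quadrature error as in the Euler–Maclaurin formula: Taylor expansion on the cells
leaves midpoint sums of higher derivatives, whose integrals are boundary values, exponentially small
in `L` (`IsJet.quadSmall_midpointQuadError`). The derivatives of `φ` are bounded by bootstrapping
the wave equation, and they decay by Landau's inequality. Part 3 takes `L` so large that the
boundary terms fall below `|lam| ^ (-1 / 2)`. -/

section

open MeasureTheory Set

/-! ### Absorption of bounds and Laplace-type tail integrals -/

/-- A bounded function which improves every upper bound `D` to `A + D / 2` is at most `2 A`. -/
theorem le_two_mul_of_forall_le_add_half {X : Type*} {s : Set X} {g : X → ℝ} {A M : ℝ}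
    (hM : ∀ x ∈ s, g x ≤ M)
    (hstep : ∀ D, (∀ x ∈ s, g x ≤ D) → ∀ x ∈ s, g x ≤ A + D / 2) :
    ∀ x ∈ s, g x ≤ 2 * A := by
  intro x hx
  have hbdd : BddAbove (g '' s) := ⟨M, by rintro _ ⟨y, hy, rfl⟩; exact hM y hy⟩
  have hD : ∀ y ∈ s, g y ≤ sSup (g '' s) := fun y hy => le_csSup hbdd ⟨y, hy, rfl⟩
  have h2 : sSup (g '' s) ≤ A + sSup (g '' s) / 2 :=
    csSup_le ⟨g x, x, hx, rfl⟩ (by rintro _ ⟨y, hy, rfl⟩; exact hstep _ hD y hy)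
  linarith [hD x hx]

/-- The decaying solution `∫_x^∞ exp (κ (x - y)) F y dy` of `g' = κ g - F`. -/
noncomputable def laplaceTail (κ : ℂ) (F : ℝ → ℂ) (x : ℝ) : ℂ :=
  Complex.exp (κ * x) * ∫ y in Ioi x, Complex.exp (-κ * y) * F y

section LaplaceTail

variable {κ : ℂ} {F G : ℝ → ℂ} {D : ℝ}

theorem norm_exp_neg_mul_ofReal (κ : ℂ) (y : ℝ) :
    ‖Complex.exp (-κ * y)‖ = Real.exp (-κ.re * y) := by
  simp [Complex.norm_exp]

/-- The kernel `exp (κ (x - y))` has mass `1 / Re κ` on `(x, ∞)`. Only values of `F` beyond `x`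
enter, which is what later makes bounds on the Riccati solution local to a half line. -/
theorem norm_laplaceTail_le (hκ : 0 < κ.re) {x : ℝ} (hF : ∀ y, x < y → ‖F y‖ ≤ D) :
    ‖laplaceTail κ F x‖ ≤ D / κ.re := by
  have hneg : -κ.re < 0 := by linarith
  have h1 : ‖∫ y in Ioi x, Complex.exp (-κ * y) * F y‖
      ≤ ∫ y in Ioi x, Real.exp (-κ.re * y) * D := by
    refine norm_integral_le_of_norm_le ((integrableOn_exp_mul_Ioi hneg x).mul_const D) ?_
    refine (ae_restrict_iff' measurableSet_Ioi).2 (Eventually.of_forall fun y hy => ?_)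
    rw [norm_mul, norm_exp_neg_mul_ofReal]
    exact mul_le_mul_of_nonneg_left (hF y hy) (Real.exp_pos _).le
  rw [integral_mul_const, integral_exp_mul_Ioi hneg] at h1
  have h2 : ‖Complex.exp (κ * x)‖ = Real.exp (κ.re * x) := by simp [Complex.norm_exp]
  rw [laplaceTail, norm_mul, h2]
  refine (mul_le_mul_of_nonneg_left h1 (Real.exp_pos _).le).trans (le_of_eq ?_)
  have h3 : Real.exp (κ.re * x) * Real.exp (-κ.re * x) = 1 := by
    rw [← Real.exp_add]; simp
  rw [neg_mul] at h3 ⊢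
  field_simp
  linear_combination D * h3

theorem integrableOn_exp_neg_mul (hκ : 0 < κ.re) (hm : Measurable F) (hF : ∀ y, ‖F y‖ ≤ D)
    (x : ℝ) : IntegrableOn (fun y : ℝ => Complex.exp (-κ * y) * F y) (Ioi x) := by
  have hneg : -κ.re < 0 := by linarith
  refine Integrable.mono' ((integrableOn_exp_mul_Ioi hneg x).mul_const D)
    (Measurable.aestronglyMeasurable (by fun_prop)) (Eventually.of_forall fun y => ?_)
  rw [norm_mul, norm_exp_neg_mul_ofReal]
  exact mul_le_mul_of_nonneg_left (hF y) (Real.exp_pos _).le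

theorem laplaceTail_sub (hκ : 0 < κ.re) (hFm : Measurable F) (hF : ∀ y, ‖F y‖ ≤ D)
    (hGm : Measurable G) (hG : ∀ y, ‖G y‖ ≤ D) (x : ℝ) :
    laplaceTail κ F x - laplaceTail κ G x = laplaceTail κ (fun y => F y - G y) x := by
  simp only [laplaceTail]
  rw [← mul_sub, ← integral_sub (integrableOn_exp_neg_mul hκ hFm hF x)
    (integrableOn_exp_neg_mul hκ hGm hG x)]
  simp only [mul_sub]

theorem intervalIntegrable_exp_neg_mul (hm : Measurable F) (hF : ∀ y, ‖F y‖ ≤ D) (a b : ℝ) :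
    IntervalIntegrable (fun y : ℝ => Complex.exp (-κ * y) * F y) volume a b := by
  have h1 : IntervalIntegrable (fun y : ℝ => ‖Complex.exp (-κ * y)‖ * D) volume a b :=
    Continuous.intervalIntegrable (by fun_prop) a b
  refine h1.mono_fun' (Measurable.aestronglyMeasurable (by fun_prop))
    (Eventually.of_forall fun y => ?_)
  simp only [norm_mul]
  exact mul_le_mul_of_nonneg_left (hF y) (norm_nonneg _)

theorem laplaceTail_eq (hκ : 0 < κ.re) (hm : Measurable F) (hF : ∀ y, ‖F y‖ ≤ D) :
    laplaceTail κ F = fun x : ℝ => Complex.exp (κ * x) *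
      ((∫ y in Ioi (0 : ℝ), Complex.exp (-κ * y) * F y)
        - ∫ y in (0 : ℝ)..x, Complex.exp (-κ * y) * F y) := by
  ext x
  rw [laplaceTail, ← intervalIntegral.integral_interval_add_Ioi'
    (intervalIntegrable_exp_neg_mul hm hF 0 x) (integrableOn_exp_neg_mul hκ hm hF x)]
  ring

theorem continuous_laplaceTail (hκ : 0 < κ.re) (hm : Measurable F) (hF : ∀ y, ‖F y‖ ≤ D) :
    Continuous (laplaceTail κ F) := by
  rw [laplaceTail_eq hκ hm hF]
  have := intervalIntegral.continuous_primitive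
    (intervalIntegrable_exp_neg_mul (κ := κ) hm hF) 0
  fun_prop

/-- Continuity is needed only at the point itself, so that the result applies to the step potential
away from its jumps. -/
theorem hasDerivAt_laplaceTail (hκ : 0 < κ.re) (hm : Measurable F) (hF : ∀ y, ‖F y‖ ≤ D)
    {x : ℝ} (hx : ContinuousAt F x) :
    HasDerivAt (laplaceTail κ F) (κ * laplaceTail κ F x - F x) x := by
  rw [laplaceTail_eq hκ hm hF]
  have hm' : Measurable fun y : ℝ => Complex.exp (-κ * y) * F y := by fun_prop
  have h1 := intervalIntegral.integral_hasDerivAt_right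
    (intervalIntegrable_exp_neg_mul (κ := κ) hm hF 0 x)
    (hm'.stronglyMeasurable.stronglyMeasurableAtFilter)
    (ContinuousAt.mul (by fun_prop) hx)
  have h2 : HasDerivAt (fun x : ℝ => Complex.exp (κ * x)) (Complex.exp (κ * x) * κ) x := by
    have := ((hasDerivAt_id x).ofReal_comp.const_mul κ).cexp
    simpa using this
  have h4 : Complex.exp (κ * x) * Complex.exp (-κ * x) = 1 := by
    rw [← Complex.exp_add]; simp
  refine (h2.mul (h1.const_sub _)).congr_deriv ?_
  linear_combination (-F x) * h4

end LaplaceTail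

/-! ### The Riccati equation for the logarithmic derivative -/

section Riccati

variable {κ : ℂ} {B S : ℝ} {θ : ℝ → ℝ}

theorem norm_sq_sub_sq_le {a b : ℂ} {ρ D : ℝ} (ha : ‖a‖ ≤ ρ) (hb : ‖b‖ ≤ ρ) (h : ‖a - b‖ ≤ D) :
    ‖a ^ 2 - b ^ 2‖ ≤ 2 * ρ * D := by
  have hρ : 0 ≤ ρ := (norm_nonneg a).trans ha
  rw [show a ^ 2 - b ^ 2 = (a + b) * (a - b) by ring, norm_mul]
  have := norm_add_le a b
  exact mul_le_mul (by linarith) h (norm_nonneg _) (by positivity)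

theorem norm_ofReal_add_sq_le {t : ℝ} {a : ℂ} {ρ : ℝ} (ht : |t| ≤ B) (ha : ‖a‖ ≤ ρ) :
    ‖(t : ℂ) + a ^ 2‖ ≤ B + ρ ^ 2 := by
  refine (norm_add_le _ _).trans (add_le_add (by simpa using ht) ?_)
  rw [norm_pow]
  exact pow_le_pow_left₀ (norm_nonneg _) ha 2

/-- A small bounded solution of the integrated Riccati equation `δ' = κ δ - θ - δ ^ 2`. -/
structure IsRiccati (κ : ℂ) (θ : ℝ → ℝ) (ρ : ℝ) (δ : ℝ → ℂ) : Prop where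
  continuous : Continuous δ
  bound : ∀ x, ‖δ x‖ ≤ ρ
  eq : ∀ x, δ x = laplaceTail κ (fun y => (θ y : ℂ) + δ y ^ 2) x

/-- The integral equation is a fixed-point problem on the ball of radius `ρ = 2 B / S` in the
bounded continuous functions. As `8 B ≤ S ^ 2` gives `ρ ^ 2 ≤ B`, the right-hand side is at most `2
B = ρ S`, so the ball is preserved; as `4 ρ ≤ S`, the quadratic term has Lipschitz constant at most
`2 ρ / S ≤ 1 / 2`. -/
theorem exists_isRiccati (hS : 0 < S) (hκ : S ≤ κ.re) (hB : 0 < B) (hBS : 8 * B ≤ S ^ 2)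
    (hm : Measurable θ) (hθ : ∀ x, |θ x| ≤ B) :
    ∃ δ, IsRiccati κ θ (2 * B / S) δ := by
  have hκ0 : 0 < κ.re := hS.trans_le hκ
  set ρ := 2 * B / S with hρ
  have hρ0 : 0 < ρ := by positivity
  have hρS : ρ * S = 2 * B := by rw [hρ]; field_simp
  have hFm : ∀ δ : BoundedContinuousFunction ℝ ℂ,
      Measurable fun y => (θ y : ℂ) + δ y ^ 2 := fun δ => by
    have := δ.continuous.measurable
    fun_prop
  have hFb : ∀ (δ : BoundedContinuousFunction ℝ ℂ) (r : ℝ), ‖δ‖ ≤ r →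
      ∀ y, ‖(θ y : ℂ) + δ y ^ 2‖ ≤ B + r ^ 2 := fun δ r hr y =>
    norm_ofReal_add_sq_le (hθ y) ((δ.norm_coe_le_norm y).trans hr)
  let T : BoundedContinuousFunction ℝ ℂ → BoundedContinuousFunction ℝ ℂ := fun δ =>
    BoundedContinuousFunction.ofNormedAddCommGroup
      (laplaceTail κ fun y => (θ y : ℂ) + δ y ^ 2)
      (continuous_laplaceTail hκ0 (hFm δ) (hFb δ _ le_rfl)) ((B + ‖δ‖ ^ 2) / κ.re)
      (fun x => norm_laplaceTail_le hκ0 fun y _ => hFb δ _ le_rfl y)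
  have hT : ∀ δ x, T δ x = laplaceTail κ (fun y => (θ y : ℂ) + δ y ^ 2) x := fun _ _ => rfl
  let s : Set (BoundedContinuousFunction ℝ ℂ) := Metric.closedBall 0 ρ
  have hs : ∀ δ, δ ∈ s ↔ ‖δ‖ ≤ ρ := fun δ => by simp [s]
  have hmaps : MapsTo T s s := by
    intro δ hδ
    rw [hs] at hδ ⊢
    refine (BoundedContinuousFunction.norm_le hρ0.le).2 fun x => ?_
    refine (norm_laplaceTail_le hκ0 fun y _ => hFb δ ρ hδ y).trans ?_
    rw [div_le_iff₀ hκ0]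
    have h1 : ρ * S ≤ ρ * κ.re := mul_le_mul_of_nonneg_left hκ hρ0.le
    have h2 : ρ ^ 2 ≤ B := by
      rw [hρ, div_pow, div_le_iff₀ (by positivity)]; nlinarith
    linarith
  have hcontr : ContractingWith (1 / 2) (hmaps.restrict T s s) := by
    refine ⟨by rw [← NNReal.coe_lt_coe]; push_cast; norm_num, LipschitzWith.of_dist_le_mul ?_⟩
    rintro ⟨δ, hδ⟩ ⟨η, hη⟩
    have hδ' := (hs δ).1 hδ
    have hη' := (hs η).1 hη
    simp only [Subtype.dist_eq, MapsTo.val_restrict_apply]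
    push_cast
    refine (BoundedContinuousFunction.dist_le (by positivity)).2 fun x => ?_
    rw [dist_eq_norm, hT, hT, laplaceTail_sub hκ0 (hFm δ) (hFb δ ρ hδ') (hFm η) (hFb η ρ hη')]
    have h1 : ∀ y, x < y →
        ‖((θ y : ℂ) + δ y ^ 2) - ((θ y : ℂ) + η y ^ 2)‖ ≤ 2 * ρ * dist δ η := fun y _ => by
      rw [add_sub_add_left_eq_sub]
      refine norm_sq_sub_sq_le ((δ.norm_coe_le_norm y).trans hδ')
        ((η.norm_coe_le_norm y).trans hη') ?_
      rw [← dist_eq_norm]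
      exact BoundedContinuousFunction.dist_coe_le_dist y
    refine (norm_laplaceTail_le hκ0 h1).trans ?_
    rw [div_le_iff₀ hκ0]
    have h3 : 4 * ρ ≤ S := by
      rw [hρ, mul_div_assoc', div_le_iff₀ hS]; nlinarith
    have h4 : 2 * ρ ≤ 1 / 2 * κ.re := by linarith
    have := mul_le_mul_of_nonneg_right h4 (dist_nonneg (x := δ) (y := η))
    linarith
  obtain ⟨δ, hδs, hfix, -⟩ := hcontr.exists_fixedPoint' Metric.isClosed_closedBall.isComplete
    hmaps (x := 0) (by simp [hs, hρ0.le]) (edist_ne_top _ _)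
  refine ⟨δ, δ.continuous, fun x => (δ.norm_coe_le_norm x).trans ((hs δ).1 hδs), fun x => ?_⟩
  rw [← hT, hfix]

namespace IsRiccati

variable {δ δ' : ℝ → ℂ} {θ' : ℝ → ℝ}

theorem measurable_rhs {ρ : ℝ} (h : IsRiccati κ θ ρ δ) (hm : Measurable θ) :
    Measurable fun y => (θ y : ℂ) + δ y ^ 2 := by
  have := h.continuous.measurable
  fun_prop

theorem hasDerivAt {ρ : ℝ} (h : IsRiccati κ θ ρ δ) (hκ : 0 < κ.re) (hm : Measurable θ)
    (hθ : ∀ x, |θ x| ≤ B) {x : ℝ} (hx : ContinuousAt θ x) :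
    HasDerivAt δ (κ * δ x - θ x - δ x ^ 2) x := by
  have hc : ContinuousAt (fun y => (θ y : ℂ) + δ y ^ 2) x := by
    have := h.continuous.continuousAt (x := x)
    exact (Complex.continuous_ofReal.continuousAt.comp hx).add (this.pow 2)
  have h1 := hasDerivAt_laplaceTail hκ (h.measurable_rhs hm)
    (fun y => norm_ofReal_add_sq_le (hθ y) (h.bound y)) hc
  rw [← funext h.eq] at h1
  exact h1.congr_deriv (by ring)

theorem four_mul_le (hS : 0 < S) (hBS : 8 * B ≤ S ^ 2) : 4 * (2 * B / S) ≤ S := by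
  rw [mul_div_assoc', div_le_iff₀ hS]; nlinarith

/-- A local bound for `θ` on `[x₀, ∞)` gives a bound for `δ` there. -/
theorem norm_le_of_forall_ge (h : IsRiccati κ θ (2 * B / S) δ) (hS : 0 < S) (hκ : S ≤ κ.re)
    (hB : 0 < B) (hBS : 8 * B ≤ S ^ 2) {x₀ b : ℝ} (hb : ∀ x, x₀ ≤ x → |θ x| ≤ b) :
    ∀ x, x₀ ≤ x → ‖δ x‖ ≤ 2 * (b / S) := by
  have hκ0 : 0 < κ.re := hS.trans_le hκ
  have hb0 : 0 ≤ b := (abs_nonneg _).trans (hb x₀ le_rfl)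
  have hρ := four_mul_le hS hBS
  refine le_two_mul_of_forall_le_add_half (s := Ici x₀) (fun x _ => h.bound x) ?_
  intro D hD x hx
  have hD0 : 0 ≤ D := (norm_nonneg _).trans (hD x hx)
  rw [h.eq]
  -- One factor of `δ ^ 2` keeps the global bound `2 B / S` and the other takes the bound `D` to be
  -- improved: the quadratic term becomes linear in `D` with a small coefficient and can be
  -- absorbed.
  have h1 : ∀ y, x < y → ‖(θ y : ℂ) + δ y ^ 2‖ ≤ b + 2 * B / S * D := fun y hy => by
    have hy' : x₀ ≤ y := le_trans hx hy.le
    refine (norm_add_le _ _).trans (add_le_add (by simpa using hb y hy') ?_)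
    rw [sq, norm_mul]
    exact mul_le_mul (h.bound y) (hD y hy') (norm_nonneg _) (by positivity)
  refine (norm_laplaceTail_le hκ0 h1).trans ?_
  refine (div_le_div_of_nonneg_left (by positivity) hS hκ).trans ?_
  rw [add_div]
  refine add_le_add_right ?_ _
  rw [div_le_div_iff₀ hS two_pos]
  nlinarith [mul_le_mul_of_nonneg_right hρ hD0]

/-- Solutions whose potentials agree on `[x₀, ∞)` agree there. -/
theorem eq_of_eqOn (h : IsRiccati κ θ (2 * B / S) δ) (h' : IsRiccati κ θ' (2 * B / S) δ')
    (hS : 0 < S) (hκ : S ≤ κ.re) (hBS : 8 * B ≤ S ^ 2)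
    (hm : Measurable θ) (hθ : ∀ x, |θ x| ≤ B) (hm' : Measurable θ') (hθ' : ∀ x, |θ' x| ≤ B)
    {x₀ : ℝ} (hb : ∀ x, x₀ ≤ x → θ x = θ' x) :
    ∀ x, x₀ ≤ x → δ x = δ' x := by
  have hκ0 : 0 < κ.re := hS.trans_le hκ
  have hρ := four_mul_le hS hBS
  have key : ∀ x ∈ Ici x₀, ‖δ x - δ' x‖ ≤ 2 * 0 := by
    refine le_two_mul_of_forall_le_add_half (M := 2 * B / S + 2 * B / S)
      (fun x _ => (norm_sub_le _ _).trans (add_le_add (h.bound x) (h'.bound x))) ?_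
    intro D hD x hx
    have hD0 : 0 ≤ D := (norm_nonneg _).trans (hD x hx)
    rw [h.eq, h'.eq, laplaceTail_sub hκ0 (h.measurable_rhs hm)
      (fun y => norm_ofReal_add_sq_le (hθ y) (h.bound y)) (h'.measurable_rhs hm')
      (fun y => norm_ofReal_add_sq_le (hθ' y) (h'.bound y))]
    have h1 : ∀ y, x < y →
        ‖((θ y : ℂ) + δ y ^ 2) - ((θ' y : ℂ) + δ' y ^ 2)‖ ≤ 2 * (2 * B / S) * D := fun y hy => by
      have hy' : x₀ ≤ y := le_trans hx hy.le
      rw [hb y hy', add_sub_add_left_eq_sub]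
      exact norm_sq_sub_sq_le (h.bound y) (h'.bound y) (hD y hy')
    refine (norm_laplaceTail_le hκ0 h1).trans ?_
    rw [div_le_iff₀ hκ0]
    nlinarith [mul_le_mul_of_nonneg_right hρ hD0, mul_le_mul_of_nonneg_right hκ hD0]
  intro x hx
  have := key x hx
  rw [mul_zero] at this
  exact sub_eq_zero.1 (norm_le_zero_iff.1 this)

end IsRiccati

end Riccati

/-! ### From the logarithmic derivative to a function normalised at `+∞` -/

section TailExp

variable {δ δ' : ℝ → ℂ} {b β : ℝ}

/-- The solution `exp (-∫_x^∞ δ)` of `E' = δ E` normalised at `+∞`. -/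
noncomputable def tailExp (δ : ℝ → ℂ) (x : ℝ) : ℂ := Complex.exp (-∫ y in Ioi x, δ y)

theorem tailExp_ne_zero (δ : ℝ → ℂ) (x : ℝ) : tailExp δ x ≠ 0 := Complex.exp_ne_zero _

theorem integrableOn_Ioi_zero_of_decay (hβ : 0 < β) (hδ : Continuous δ)
    (hb : ∀ x, 0 ≤ x → ‖δ x‖ ≤ b * Real.exp (-β * x)) : IntegrableOn δ (Ioi 0) := by
  have hneg : -β < 0 := by linarith
  refine Integrable.mono' ((integrableOn_exp_mul_Ioi hneg 0).const_mul b)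
    hδ.aestronglyMeasurable ?_
  exact (ae_restrict_iff' measurableSet_Ioi).2 (Eventually.of_forall fun y hy => hb y (le_of_lt hy))

theorem integral_Ioi_eq_sub (hδ : Continuous δ) (hi : IntegrableOn δ (Ioi 0)) (x : ℝ) :
    ∫ y in Ioi x, δ y = (∫ y in Ioi (0 : ℝ), δ y) - ∫ y in (0 : ℝ)..x, δ y := by
  rw [← intervalIntegral.integral_interval_add_Ioi' (hδ.intervalIntegrable x 0) hi,
    intervalIntegral.integral_symm]
  ring

theorem hasDerivAt_tailExp (hδ : Continuous δ) (hi : IntegrableOn δ (Ioi 0)) (x : ℝ) :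
    HasDerivAt (tailExp δ) (δ x * tailExp δ x) x := by
  have h1 := intervalIntegral.integral_hasDerivAt_right (hδ.intervalIntegrable 0 x)
    hδ.stronglyMeasurable.stronglyMeasurableAtFilter hδ.continuousAt
  have h2 := ((h1.const_sub (∫ y in Ioi (0 : ℝ), δ y)).neg).cexp
  have h3 : tailExp δ = fun x => Complex.exp (-((∫ y in Ioi (0 : ℝ), δ y)
      - ∫ y in (0 : ℝ)..x, δ y)) := by
    ext x
    rw [tailExp, integral_Ioi_eq_sub hδ hi]
  rw [h3]
  exact h2.congr_deriv (by simp; ring)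

theorem tendsto_tailExp (hδ : Continuous δ) (hi : IntegrableOn δ (Ioi 0)) :
    Tendsto (tailExp δ) atTop (𝓝 1) := by
  have h1 := (intervalIntegral_tendsto_integral_Ioi 0 hi tendsto_id).const_sub
    (∫ y in Ioi (0 : ℝ), δ y)
  have h2 := (h1.neg).cexp
  simp only [sub_self, neg_zero, Complex.exp_zero] at h2
  refine h2.congr fun x => ?_
  rw [tailExp, integral_Ioi_eq_sub hδ hi x, id]

theorem norm_tailExp_zero_sub_one_le (hβ : 0 < β)
    (hb : ∀ x, 0 ≤ x → ‖δ x‖ ≤ b * Real.exp (-β * x)) (hbβ : b ≤ β) :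
    ‖tailExp δ 0 - 1‖ ≤ 2 * (b / β) := by
  have hneg : -β < 0 := by linarith
  have h1 : ‖∫ y in Ioi (0 : ℝ), δ y‖ ≤ b / β := by
    refine (norm_integral_le_of_norm_le ((integrableOn_exp_mul_Ioi hneg 0).const_mul b)
      ((ae_restrict_iff' measurableSet_Ioi).2
        (Eventually.of_forall fun y hy => hb y (le_of_lt hy)))).trans (le_of_eq ?_)
    rw [integral_const_mul, integral_exp_mul_Ioi hneg]
    simp
    rfl
  have h2 : b / β ≤ 1 := (div_le_one hβ).2 hbβ
  have h3 := Complex.norm_exp_sub_one_le (x := -∫ y in Ioi (0 : ℝ), δ y)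
    (by rw [norm_neg]; exact h1.trans h2)
  rw [norm_neg] at h3
  exact h3.trans (by linarith)

theorem tailExp_congr {x : ℝ} (h : ∀ y, x ≤ y → δ y = δ' y) : tailExp δ x = tailExp δ' x := by
  rw [tailExp, tailExp, setIntegral_congr_fun measurableSet_Ioi fun y hy => h y (le_of_lt hy)]

end TailExp

/-! ### The first-order system, Lagrange's identity and Jost vectors -/

/-- The coefficient matrix of `u'' + c u' + (v - lam) u = 0` written as a first order system. -/
def coeffMatrix (c : ℝ) (lam : ℂ) (v : ℝ) : Matrix (Fin 2) (Fin 2) ℂ :=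
  !![0, 1; lam - (v : ℂ), -(c : ℂ)]

section System

variable {c : ℝ} {lam κ μ : ℂ} {v w : ℝ} {y z : ℝ → Fin 2 → ℂ} {x : ℝ}

theorem coeffMatrix_mulVec (c : ℝ) (lam : ℂ) (v : ℝ) (y : Fin 2 → ℂ) :
    (coeffMatrix c lam v).mulVec y = ![y 1, (lam - v) * y 0 - c * y 1] := by
  ext i
  fin_cases i <;> simp [coeffMatrix, Matrix.mulVec, dotProduct, Fin.sum_univ_two]
  ring

theorem hasDerivAt_system_iff :
    HasDerivAt y ((coeffMatrix c lam v).mulVec (y x)) x ↔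
      HasDerivAt (fun t => y t 0) (y x 1) x ∧
        HasDerivAt (fun t => y t 1) ((lam - v) * y x 0 - c * y x 1) x := by
  rw [coeffMatrix_mulVec, hasDerivAt_pi, Fin.forall_fin_two]
  rfl

theorem wedge_eq (y z : Fin 2 → ℂ) : wedge y z = y 0 * z 1 - z 0 * y 1 := by
  simp [wedge, Matrix.det_fin_two]

theorem hasDerivAt_exp_ofReal_mul (μ : ℂ) (x : ℝ) :
    HasDerivAt (fun t : ℝ => Complex.exp (μ * t)) (μ * Complex.exp (μ * x)) x := by
  have := ((hasDerivAt_id x).ofReal_comp.const_mul μ).cexp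
  exact this.congr_deriv (by simp; ring)

/-- Lagrange's identity for two potentials. -/
theorem hasDerivAt_exp_mul_wedge (hy : HasDerivAt y ((coeffMatrix c lam v).mulVec (y x)) x)
    (hz : HasDerivAt z ((coeffMatrix c lam w).mulVec (z x)) x) :
    HasDerivAt (fun t : ℝ => Complex.exp (c * t) * wedge (y t) (z t))
      (Complex.exp (c * x) * (y x 0 * z x 0) * (v - w)) x := by
  obtain ⟨hy0, hy1⟩ := hasDerivAt_system_iff.1 hy
  obtain ⟨hz0, hz1⟩ := hasDerivAt_system_iff.1 hz
  simp only [wedge_eq]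
  refine ((hasDerivAt_exp_ofReal_mul c x).mul
    ((hy0.mul hz1).sub (hz0.mul hy1))).congr_deriv ?_
  simp only [Pi.mul_apply, Pi.sub_apply]
  ring

/-- The vector `(u, u')` with `u = exp (μ x) exp (-∫_x^∞ δ)`. -/
noncomputable def jostVector (μ : ℂ) (δ : ℝ → ℂ) (x : ℝ) : Fin 2 → ℂ :=
  ![Complex.exp (μ * x) * tailExp δ x, (μ + δ x) * (Complex.exp (μ * x) * tailExp δ x)]

theorem hasDerivAt_jostVector_zero {δ : ℝ → ℂ} (hδ : Continuous δ) (hi : IntegrableOn δ (Ioi 0))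
    (x : ℝ) :
    HasDerivAt (fun t => jostVector μ δ t 0) (jostVector μ δ x 1) x := by
  simp only [jostVector, Matrix.cons_val_zero, Matrix.cons_val_one]
  refine ((hasDerivAt_exp_ofReal_mul μ x).mul (hasDerivAt_tailExp hδ hi x)).congr_deriv ?_
  ring

/-- If `u' = (μ + δ) u`, then `u'' + c u' + (v + t - lam) u = 0` is the Riccati equation for `δ`:
`hμ` removes the terms free of `δ`, and `hκ` turns the linear coefficient `-(c + 2 μ)` into `κ`. -/
theorem hasDerivAt_jostVector {δ : ℝ → ℂ} (hδ : Continuous δ) (hi : IntegrableOn δ (Ioi 0))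
    {t : ℝ} (hd : HasDerivAt δ (κ * δ x - t - δ x ^ 2) x) (hκ : κ + 2 * μ = -c)
    (hμ : μ ^ 2 + c * μ = lam - v) :
    HasDerivAt (jostVector μ δ)
      ((coeffMatrix c lam (v + t)).mulVec (jostVector μ δ x)) x := by
  have h0 := hasDerivAt_jostVector_zero (μ := μ) hδ hi x
  refine hasDerivAt_system_iff.2 ⟨h0, ?_⟩
  have h1 := (hd.const_add μ).mul h0
  refine h1.congr_deriv ?_
  simp only [jostVector, Matrix.cons_val_zero, Matrix.cons_val_one]
  push_cast
  linear_combination (δ x * (Complex.exp (μ * x) * tailExp δ x)) * hκ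
    + (Complex.exp (μ * x) * tailExp δ x) * hμ

theorem continuous_jostVector {δ : ℝ → ℂ} (hδ : Continuous δ) (hi : IntegrableOn δ (Ioi 0)) :
    Continuous (jostVector μ δ) := by
  have h1 : Continuous (tailExp δ) :=
    continuous_iff_continuousAt.2 fun x => (hasDerivAt_tailExp hδ hi x).continuousAt
  refine continuous_pi fun i => ?_
  fin_cases i <;> simp only [jostVector] <;> simp <;> fun_prop

theorem jostVector_zero_ne_zero (μ : ℂ) (δ : ℝ → ℂ) (x : ℝ) : jostVector μ δ x 0 ≠ 0 := by
  simp [jostVector, tailExp_ne_zero, Complex.exp_ne_zero]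

theorem tendsto_jostVector {δ : ℝ → ℂ} (hδ : Continuous δ) (hi : IntegrableOn δ (Ioi 0))
    (h0 : Tendsto δ atTop (𝓝 0)) :
    Tendsto (fun ξ : ℝ => Complex.exp (-(μ * (ξ : ℂ))) • jostVector μ δ ξ) atTop
      (𝓝 ![1, μ]) := by
  have hE := tendsto_tailExp hδ hi
  have hexp : ∀ ξ : ℝ, Complex.exp (-(μ * ξ)) * Complex.exp (μ * ξ) = 1 := fun ξ => by
    rw [← Complex.exp_add]; simp
  rw [tendsto_pi_nhds, Fin.forall_fin_two]
  constructor
  · refine hE.congr fun ξ => ?_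
    simp only [jostVector, Pi.smul_apply, Matrix.cons_val_zero, smul_eq_mul]
    linear_combination (-tailExp δ ξ) * hexp ξ
  · have h2 := (h0.const_add μ).mul hE
    simp only [add_zero, mul_one] at h2
    refine h2.congr fun ξ => ?_
    simp only [jostVector, Pi.smul_apply, Matrix.cons_val_one, smul_eq_mul]
    simp only [Matrix.cons_val_fin_one]
    linear_combination (-(μ + δ ξ) * tailExp δ ξ) * hexp ξ

end System

/-! ### Existence and uniqueness of the right solution -/

section RightSolution

variable {f uh : ℝ → ℝ} {c u₀ : ℝ} {lam : ℂ}

theorem evansKappa_sq (f : ℝ → ℝ) (c u₀ : ℝ) (lam : ℂ) :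
    evansKappa f c u₀ lam ^ 2 = (c : ℂ) ^ 2 + 4 * (lam - ((deriv f u₀ : ℝ) : ℂ)) := by
  simp [evansKappa]

theorem evansKappa_add_two_mul_evansMu₂ :
    evansKappa f c u₀ lam + 2 * evansMu₂ f c u₀ lam = -c := by
  rw [evansMu₂]; ring

theorem evansMu₂_sq_add :
    evansMu₂ f c u₀ lam ^ 2 + c * evansMu₂ f c u₀ lam = lam - ((deriv f u₀ : ℝ) : ℂ) := by
  rw [evansMu₂]; linear_combination (1 / 4 : ℂ) * evansKappa_sq f c u₀ lam

/-- Any right solution coincides with a nonvanishing one. -/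
theorem IsRightEvansSolution.eq_of_ne_zero {y z : ℝ → Fin 2 → ℂ}
    (hκ : 0 < (evansKappa f c u₀ lam).re)
    (hz : IsRightEvansSolution f c u₀ uh lam z) (hz0 : ∀ x, z x 0 ≠ 0)
    (hy : IsRightEvansSolution f c u₀ uh lam y) : y = z := by
  set μ := evansMu₂ f c u₀ lam with hμ
  set κ := evansKappa f c u₀ lam with hκ_def
  have hconst : ∀ x : ℝ, Complex.exp (c * x) * wedge (z x) (y x)
      = Complex.exp (c * (0 : ℝ)) * wedge (z 0) (y 0) := by
    have hd : ∀ x, HasDerivAt (fun t : ℝ => Complex.exp (c * t) * wedge (z t) (y t)) 0 x :=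
      fun x => (hasDerivAt_exp_mul_wedge (hz.1 x) (hy.1 x)).congr_deriv (by simp)
    exact fun x => is_const_of_deriv_eq_zero (fun x => (hd x).differentiableAt)
      (fun x => (hd x).deriv) x 0
  -- Since `c + 2 μ = -κ`, the weighted Wronskian is `exp (-κ x)` times that of the normalised
  -- vectors. The latter converges and `Re κ > 0`, so the constant Wronskian is zero.
  have hlim : Tendsto (fun x : ℝ => Complex.exp (c * x) * wedge (z x) (y x)) atTop (𝓝 0) := by
    have h1 := tendsto_pi_nhds.1 hz.2
    have h2 := tendsto_pi_nhds.1 hy.2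
    have h3 := ((h1 0).mul (h2 1)).sub ((h2 0).mul (h1 1))
    have h4 : Tendsto (fun x : ℝ => Complex.exp (-κ * x)) atTop (𝓝 0) := by
      rw [Complex.tendsto_exp_nhds_zero_iff]
      simpa using Tendsto.const_mul_atTop_of_neg (r := -κ.re) (by linarith) tendsto_id
    have h5 := h4.mul h3
    simp only [zero_mul] at h5
    refine h5.congr fun x => ?_
    have h6 : Complex.exp (-κ * x) * (Complex.exp (-(μ * x)) * Complex.exp (-(μ * x)))
        = Complex.exp (c * x) := by
      rw [← Complex.exp_add, ← Complex.exp_add]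
      congr 1
      linear_combination (-x : ℂ) * evansKappa_add_two_mul_evansMu₂ (f := f) (c := c) (u₀ := u₀)
        (lam := lam)
    simp only [Pi.smul_apply, smul_eq_mul, wedge_eq]
    rw [← h6]
    ring
  have hw : ∀ x, wedge (z x) (y x) = 0 := by
    intro x
    have h1 := tendsto_nhds_unique (hlim.congr hconst) tendsto_const_nhds
    have h2 := hconst x
    rw [← h1] at h2
    exact (mul_eq_zero.1 h2).resolve_left (Complex.exp_ne_zero _)
  have hq : ∀ x, HasDerivAt (fun t => y t 0 / z t 0) 0 x := by
    intro x
    have h1 := (hasDerivAt_system_iff.1 (hy.1 x)).1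
    have h2 := (hasDerivAt_system_iff.1 (hz.1 x)).1
    refine (h1.div h2 (hz0 x)).congr_deriv ?_
    have := hw x
    rw [wedge_eq] at this
    rw [div_eq_zero_iff]
    left
    linear_combination this
  -- The solutions are proportional, with a constant ratio of first components; the common
  -- normalisation at `+∞` makes it `1`.
  have hqc : ∀ x, y x 0 / z x 0 = 1 := by
    have h1 : ∀ x, y x 0 / z x 0 = y 0 0 / z 0 0 := fun x =>
      is_const_of_deriv_eq_zero (fun x => (hq x).differentiableAt) (fun x => (hq x).deriv) x 0
    have h2 : Tendsto (fun x => y x 0 / z x 0) atTop (𝓝 1) := by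
      have h3 := (tendsto_pi_nhds.1 hy.2 0).div (tendsto_pi_nhds.1 hz.2 0) (by simp)
      simp only [Matrix.cons_val_zero, div_one] at h3
      refine h3.congr fun x => ?_
      simp only [Pi.smul_apply, smul_eq_mul, Pi.div_apply]
      exact mul_div_mul_left _ _ (Complex.exp_ne_zero _)
    intro x
    rw [h1 x]
    exact tendsto_nhds_unique (tendsto_const_nhds.congr fun x => (h1 x).symm) h2
  ext x i
  have h0 : y x 0 = z x 0 := (div_eq_one_iff_eq (hz0 x)).1 (hqc x)
  have h1 : y x 1 = z x 1 := by
    have := hw x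
    rw [wedge_eq, h0, ← mul_sub] at this
    exact sub_eq_zero.1 ((mul_eq_zero.1 this).resolve_left (hz0 x))
  fin_cases i
  exacts [h0, h1]

end RightSolution

namespace IsRiccati

variable {κ : ℂ} {B β S : ℝ} {θ : ℝ → ℝ} {δ : ℝ → ℂ}

/-- The half-line bound is applied at `x₀ = x` itself, with `b` the value of the decreasing weight
there; thus `δ` inherits the decay rate of the potential. -/
theorem norm_le_exp (h : IsRiccati κ θ (2 * B / S) δ) (hS : 0 < S) (hκ : S ≤ κ.re)
    (hB : 0 < B) (hBS : 8 * B ≤ S ^ 2) (hβ : 0 < β)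
    (hdecay : ∀ x, 0 ≤ x → |θ x| ≤ B * Real.exp (-β * x)) (x : ℝ) (hx : 0 ≤ x) :
    ‖δ x‖ ≤ 2 * B / S * Real.exp (-β * x) := by
  have := h.norm_le_of_forall_ge hS hκ hB hBS (x₀ := x) (b := B * Real.exp (-β * x))
    (fun y hy => (hdecay y (hx.trans hy)).trans
      (mul_le_mul_of_nonneg_left (Real.exp_le_exp.2 (by nlinarith)) hB.le)) x le_rfl
  exact this.trans (le_of_eq (by ring))

theorem tendsto_zero {b : ℝ} (hβ : 0 < β)
    (hb : ∀ x, 0 ≤ x → ‖δ x‖ ≤ b * Real.exp (-β * x)) : Tendsto δ atTop (𝓝 0) := by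
  have h1 : Tendsto (fun x : ℝ => b * Real.exp (-β * x)) atTop (𝓝 (b * 0)) :=
    (Real.tendsto_exp_atBot.comp
      (tendsto_id.const_mul_atTop_of_neg (by linarith : -β < 0))).const_mul b
  rw [mul_zero] at h1
  exact squeeze_zero_norm' ((eventually_ge_atTop 0).mono fun x hx => hb x hx) h1

end IsRiccati

section RightExistence

variable {f uh : ℝ → ℝ} {c u₀ : ℝ} {lam : ℂ} {B β S : ℝ}

/-- `φ` is within `B` of `l` everywhere and within `B exp (-β x)` of `l` for `x ≥ 0`. -/
structure RightDecay (φ : ℝ → ℝ) (l B β : ℝ) : Prop where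
  measurable : Measurable φ
  bound : ∀ x, |φ x - l| ≤ B
  decay : ∀ x, 0 ≤ x → |φ x - l| ≤ B * Real.exp (-β * x)

/-- The right solution is the Jost vector of the Riccati solution. -/
theorem isRightEvansSolution_jostVector {δ : ℝ → ℂ} (hB : 0 < B) (hβ : 0 < β)
    (hφc : Continuous (wavePotential f uh))
    (hφ : RightDecay (wavePotential f uh) (deriv f u₀) B β)
    (hS : 0 < S) (hBS : 8 * B ≤ S ^ 2) (hκ : S ≤ (evansKappa f c u₀ lam).re)
    (hδ : IsRiccati (evansKappa f c u₀ lam) (fun x => wavePotential f uh x - deriv f u₀)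
      (2 * B / S) δ) :
    IsRightEvansSolution f c u₀ uh lam (jostVector (evansMu₂ f c u₀ lam) δ) := by
  have hb := hδ.norm_le_exp hS hκ hB hBS hβ hφ.decay
  have hi := integrableOn_Ioi_zero_of_decay hβ hδ.continuous hb
  refine ⟨fun x => ?_, tendsto_jostVector hδ.continuous hi (IsRiccati.tendsto_zero hβ hb)⟩
  have hd := hδ.hasDerivAt (hS.trans_le hκ) (hφ.measurable.sub_const _) hφ.bound (x := x)
    (by fun_prop)
  have := hasDerivAt_jostVector hδ.continuous hi hd (evansKappa_add_two_mul_evansMu₂)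
    (evansMu₂_sq_add)
  rwa [add_sub_cancel] at this

theorem existsUnique_isRightEvansSolution (hB : 0 < B) (hβ : 0 < β)
    (hφc : Continuous (wavePotential f uh))
    (hφ : RightDecay (wavePotential f uh) (deriv f u₀) B β)
    (hS : 0 < S) (hBS : 8 * B ≤ S ^ 2) (hκ : S ≤ (evansKappa f c u₀ lam).re) :
    ∃! y, IsRightEvansSolution f c u₀ uh lam y := by
  obtain ⟨δ, hδ⟩ := exists_isRiccati hS hκ hB hBS (hφ.measurable.sub_const _) hφ.bound
  have h := isRightEvansSolution_jostVector hB hβ hφc hφ hS hBS hκ hδ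
  exact ⟨_, h, fun y hy => h.eq_of_ne_zero (hS.trans_le hκ) (jostVector_zero_ne_zero _ _) hy⟩

end RightExistence

/-! ### The left solution by reflection -/

section Reflection

variable {f uh : ℝ → ℝ} {c u₀ : ℝ} {lam : ℂ} {y : ℝ → Fin 2 → ℂ}

/-- The reflection `x ↦ -x` of a vector `(u, u')`. -/
def reflect (y : ℝ → Fin 2 → ℂ) (x : ℝ) : Fin 2 → ℂ := ![y (-x) 0, -y (-x) 1]

theorem reflect_reflect (y : ℝ → Fin 2 → ℂ) : reflect (reflect y) = y := by
  ext x i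
  fin_cases i <;> simp [reflect]

theorem evansKappa_neg : evansKappa f (-c) u₀ lam = evansKappa f c u₀ lam := by
  simp [evansKappa]

theorem evansMu₂_neg : evansMu₂ f (-c) u₀ lam = -evansMu₁ f c u₀ lam := by
  simp only [evansMu₁, evansMu₂, evansKappa_neg]
  push_cast
  ring

theorem hasDerivAt_reflect {v x : ℝ}
    (h : HasDerivAt y ((coeffMatrix c lam v).mulVec (y (-x))) (-x)) :
    HasDerivAt (reflect y) ((coeffMatrix (-c) lam v).mulVec (reflect y x)) x := by
  obtain ⟨h0, h1⟩ := hasDerivAt_system_iff.1 h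
  have hn := hasDerivAt_neg x
  refine hasDerivAt_system_iff.2 ⟨?_, ?_⟩
  · exact (h0.scomp x hn).congr_deriv (by simp [reflect])
  · refine ((h1.scomp x hn).neg).congr_deriv ?_
    simp [reflect]

theorem IsEvansSolution.reflect (h : IsEvansSolution f c uh lam y) :
    IsEvansSolution f (-c) (fun x => uh (-x)) lam (reflect y) := fun ξ =>
  hasDerivAt_reflect (h (-ξ))

/-- Reflection exchanges `c` with `-c` and `-μ₁` with `μ₂`, so left solutions need no theory of
their own. The sign on the second component in `reflect` accounts for the derivative. -/
theorem isRightEvansSolution_reflect (h : IsLeftEvansSolution f c u₀ uh lam y) :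
    IsRightEvansSolution f (-c) u₀ (fun x => uh (-x)) lam (reflect y) := by
  refine ⟨h.1.reflect, ?_⟩
  have h1 := h.2.comp tendsto_neg_atTop_atBot
  rw [tendsto_pi_nhds, Fin.forall_fin_two] at h1 ⊢
  rw [evansMu₂_neg]
  refine ⟨h1.1.congr fun x => ?_, (h1.2.neg.congr fun x => ?_)⟩ <;> simp [reflect]

theorem isLeftEvansSolution_reflect
    (h : IsRightEvansSolution f (-c) u₀ (fun x => uh (-x)) lam y) :
    IsLeftEvansSolution f c u₀ uh lam (reflect y) := by
  refine ⟨?_, ?_⟩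
  · have := h.1.reflect
    simpa only [neg_neg] using this
  have h1 := h.2.comp tendsto_neg_atBot_atTop
  rw [tendsto_pi_nhds, Fin.forall_fin_two] at h1 ⊢
  rw [evansMu₂_neg] at h1
  refine ⟨h1.1.congr fun x => ?_, ?_⟩
  · simp [reflect]
  · have h2 := h1.2.neg
    simp only [Matrix.cons_val_one, Matrix.cons_val_fin_one, neg_neg] at h2
    refine h2.congr fun x => ?_
    simp [reflect]

theorem existsUnique_isLeftEvansSolution
    (h : ∃! y, IsRightEvansSolution f (-c) u₀ (fun x => uh (-x)) lam y) :
    ∃! y, IsLeftEvansSolution f c u₀ uh lam y := by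
  obtain ⟨y, hy, huniq⟩ := h
  refine ⟨reflect y, isLeftEvansSolution_reflect hy, fun z hz => ?_⟩
  rw [← huniq _ (isRightEvansSolution_reflect hz), reflect_reflect]

theorem evansLeft_eq (h : ∃! y, IsLeftEvansSolution f c u₀ uh lam y)
    (hy : IsLeftEvansSolution f c u₀ uh lam y) : evansLeft f c u₀ uh lam = y :=
  h.unique (Classical.epsilon_spec h.exists) hy

theorem evansRight_eq (h : ∃! y, IsRightEvansSolution f c u₀ uh lam y)
    (hy : IsRightEvansSolution f c u₀ uh lam y) : evansRight f c u₀ uh lam = y :=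
  h.unique (Classical.epsilon_spec h.exists) hy

end Reflection

/-! ### The step potential -/

section StepPotential

variable {φ : ℝ → ℝ} {h l B β : ℝ} {N : ℕ} {x : ℝ}

/-- The potential replaced on `[-N h, N h)` by its midpoint values on the cells
`[j h, (j + 1) h)`. -/
noncomputable def stepPotential (φ : ℝ → ℝ) (h : ℝ) (N : ℕ) (x : ℝ) : ℝ :=
  if -(N * h) ≤ x ∧ x < N * h then φ (⌊x / h⌋ * h + h / 2) else φ x

theorem measurable_stepPotential (hφ : Measurable φ) : Measurable (stepPotential φ h N) := by
  refine Measurable.ite (measurableSet_Ici.inter measurableSet_Iio) (hφ.comp ?_) hφ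
  have h1 : Measurable fun x : ℝ => ((⌊x / h⌋ : ℤ) : ℝ) :=
    measurable_from_top.comp (Int.measurable_floor.comp (measurable_id.div_const h))
  fun_prop

theorem stepPotential_of_ge (hx : N * h ≤ x) : stepPotential φ h N x = φ x := by
  rw [stepPotential, if_neg (by intro h; linarith [h.2])]

/-- Zero is a node, so the midpoint of a cell lies on the same side of `0` as the cell and at least
half as far out as any of its points. Sampling at midpoints therefore costs only a factor `2` in the
decay rate, whatever the step. -/
theorem stepPotential_eq_or (hh : 0 < h) (φ : ℝ → ℝ) (N : ℕ) (x : ℝ) :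
    ∃ m, stepPotential φ h N x = φ m ∧ (0 ≤ x → x / 2 ≤ m) ∧ (x < 0 → m ≤ x / 2) := by
  rw [stepPotential]
  split_ifs
  · refine ⟨_, rfl, fun hx => ?_, fun hx => ?_⟩
    · have h1 := Int.lt_floor_add_one (x / h)
      have h2 : (0 : ℝ) ≤ ⌊x / h⌋ := by exact_mod_cast Int.floor_nonneg.2 (by positivity)
      rw [div_lt_iff₀ hh] at h1
      nlinarith
    · have h1 := Int.floor_le (x / h)
      have h2 : ⌊x / h⌋ ≤ -1 := by
        have : ⌊x / h⌋ < 0 := Int.floor_lt.2 (by simpa using div_neg_of_neg_of_pos hx hh)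
        omega
      have h3 : (⌊x / h⌋ : ℝ) ≤ -1 := by exact_mod_cast h2
      rw [le_div_iff₀ hh] at h1
      nlinarith
  · exact ⟨x, rfl, fun hx => by linarith, fun hx => by linarith⟩

theorem rightDecay_stepPotential (hh : 0 < h) (hβ : 0 < β) (hφ : RightDecay φ l B (2 * β))
    (N : ℕ) : RightDecay (stepPotential φ h N) l B β := by
  have hB : 0 ≤ B := (abs_nonneg _).trans (hφ.bound 0)
  refine ⟨measurable_stepPotential hφ.measurable, fun x => ?_, fun x hx => ?_⟩
  · obtain ⟨m, hm, -, -⟩ := stepPotential_eq_or hh φ N x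
    rw [hm]
    exact hφ.bound m
  · obtain ⟨m, hm, hm', -⟩ := stepPotential_eq_or hh φ N x
    rw [hm]
    have := hm' hx
    exact (hφ.decay m (by linarith)).trans
      (mul_le_mul_of_nonneg_left (Real.exp_le_exp.2 (by nlinarith)) hB)

theorem RightDecay.mono {β' : ℝ} (hφ : RightDecay φ l B β) (hβ : β' ≤ β) :
    RightDecay φ l B β' := by
  have hB : 0 ≤ B := (abs_nonneg _).trans (hφ.bound 0)
  exact ⟨hφ.measurable, hφ.bound, fun x hx => (hφ.decay x hx).trans
    (mul_le_mul_of_nonneg_left (Real.exp_le_exp.2 (by nlinarith)) hB)⟩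

/-- Both potentials are compared with the limit on the side of `x`. The bound does not involve `h`
or `N`, so `∫ |φs - φ|` is bounded uniformly. -/
theorem abs_stepPotential_sub_le {l' : ℝ} (hh : 0 < h) (hβ : 0 < β)
    (hr : RightDecay φ l B (2 * β)) (hl : RightDecay (fun x => φ (-x)) l' B (2 * β)) (N : ℕ)
    (x : ℝ) : |stepPotential φ h N x - φ x| ≤ 2 * B * Real.exp (-β * |x|) := by
  rcases le_or_gt 0 x with hx | hx
  · have h1 := (rightDecay_stepPotential hh hβ hr N).decay x hx
    have h2 := (hr.mono (β' := β) (by linarith)).decay x hx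
    rw [abs_of_nonneg hx]
    have := abs_sub_le (stepPotential φ h N x) l (φ x)
    rw [abs_sub_comm l] at this
    linarith
  · have hB : 0 ≤ B := (abs_nonneg _).trans (hr.bound 0)
    obtain ⟨m, hm, -, hm'⟩ := stepPotential_eq_or hh φ N x
    have h2 := (hl.mono (β' := β) (by linarith)).decay (-x) (by linarith)
    have h1 := hl.decay (-m) (by linarith [hm' hx])
    simp only [neg_neg] at h1 h2
    have h3 : Real.exp (-(2 * β) * -m) ≤ Real.exp (-β * -x) :=
      Real.exp_le_exp.2 (by nlinarith [hm' hx])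
    rw [abs_of_neg hx, hm]
    have := abs_sub_le (φ m) l' (φ x)
    rw [abs_sub_comm l'] at this
    have h4 := mul_le_mul_of_nonneg_left h3 hB
    linarith

/-- The nodes `-N h + k h`. -/
def node (h : ℝ) (N k : ℕ) : ℝ := -(N * h) + k * h

theorem node_succ (h : ℝ) (N k : ℕ) : node h N (k + 1) = node h N k + h := by
  simp only [node]; push_cast; ring

theorem node_zero (h : ℝ) (N : ℕ) : node h N 0 = -(N * h) := by simp [node]

theorem node_two_mul (h : ℝ) (N : ℕ) : node h N (2 * N) = N * h := by
  simp only [node]; push_cast; ring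

theorem stepPotential_of_mem (hh : 0 < h) {k : ℕ} (hk : k < 2 * N)
    (hx : x ∈ Ico (node h N k) (node h N (k + 1))) :
    stepPotential φ h N x = φ (node h N k + h / 2) := by
  rw [node_succ] at hx
  obtain ⟨h1, h2⟩ := hx
  simp only [node] at h1 h2
  have hk' : (k : ℝ) + 1 ≤ 2 * N := by exact_mod_cast hk
  have hk0 : (0 : ℝ) ≤ k := Nat.cast_nonneg k
  have hfl : ⌊x / h⌋ = (k : ℤ) - N := by
    rw [Int.floor_eq_iff]
    push_cast
    rw [le_div_iff₀ hh, div_lt_iff₀ hh]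
    constructor <;> nlinarith
  rw [stepPotential, if_pos ⟨by nlinarith, by nlinarith⟩, hfl]
  congr 1
  simp only [node]
  push_cast
  ring

theorem stepPotential_eventuallyEq (hh : 0 < h) {k : ℕ} (hk : k < 2 * N)
    (hx : x ∈ Ioo (node h N k) (node h N (k + 1))) :
    stepPotential φ h N =ᶠ[𝓝 x] fun _ => φ (node h N k + h / 2) := by
  filter_upwards [Ioo_mem_nhds hx.1 hx.2] with y hy
  exact stepPotential_of_mem hh hk (Ioo_subset_Ico_self hy)

/-- A point of `(-N h, N h)` which is not a node lies in an open cell. -/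
theorem exists_mem_cell (hh : 0 < h) (hx : x ∈ Ioo (-(N * h)) (N * h))
    (hx' : x ∉ range (node h N)) :
    ∃ k < 2 * N, x ∈ Ioo (node h N k) (node h N (k + 1)) := by
  have h0 : 0 ≤ (x + N * h) / h := div_nonneg (by linarith [hx.1]) hh.le
  have h1 := Nat.floor_le h0
  have h2 := Nat.lt_floor_add_one ((x + N * h) / h)
  rw [le_div_iff₀ hh] at h1
  rw [div_lt_iff₀ hh] at h2
  set k := ⌊(x + N * h) / h⌋₊
  refine ⟨k, ?_, lt_of_le_of_ne ?_ fun he => hx' ⟨k, he⟩, ?_⟩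
  · by_contra! hk
    have hk' : (2 * N : ℝ) ≤ k := by exact_mod_cast hk
    nlinarith [hx.2]
  · simp only [node]; linarith
  · rw [node_succ]; simp only [node]; linarith

end StepPotential

/-! ### Matrix exponentials as flows -/

section ExpMidpoint

theorem wedge_mulVec (M : Matrix (Fin 2) (Fin 2) ℂ) (y z : Fin 2 → ℂ) :
    wedge (M.mulVec y) (M.mulVec z) = M.det * wedge y z := by
  simp only [wedge_eq, Matrix.det_fin_two, Matrix.mulVec, dotProduct, Fin.sum_univ_two]
  ring

open scoped Matrix.Norms.Operator in
theorem hasDerivAt_exp_ofReal_smul (A : Matrix (Fin 2) (Fin 2) ℂ) (x : ℝ) :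
    HasDerivAt (fun t : ℝ => NormedSpace.exp ((t : ℂ) • A))
      (NormedSpace.exp ((x : ℂ) • A) * A) x := by
  have h1 := hasDerivAt_exp_smul_const (𝕂 := ℂ) A (x : ℂ)
  exact (h1.scomp x (hasDerivAt_id x).ofReal_comp).congr_deriv (one_smul _ _)

theorem hasDerivAt_exp_ofReal_smul_apply (A : Matrix (Fin 2) (Fin 2) ℂ) (i j : Fin 2) (x : ℝ) :
    HasDerivAt (fun t : ℝ => NormedSpace.exp ((t : ℂ) • A) i j)
      ((NormedSpace.exp ((x : ℂ) • A) * A) i j) x :=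
  hasDerivAt_pi.1 (hasDerivAt_pi.1 (hasDerivAt_exp_ofReal_smul A x) i) j

theorem exp_smul_mul_exp_smul (A : Matrix (Fin 2) (Fin 2) ℂ) (s t : ℂ) :
    NormedSpace.exp (s • A) * NormedSpace.exp (t • A) = NormedSpace.exp ((s + t) • A) := by
  rw [add_smul, Matrix.exp_add_of_commute]
  exact ((Commute.refl A).smul_left s).smul_right t

/-- The flow of a constant matrix is its exponential. -/
theorem eq_exp_smul_mulVec {A : Matrix (Fin 2) (Fin 2) ℂ} {z : ℝ → Fin 2 → ℂ} {a b : ℝ}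
    (hz : Continuous z) (hd : ∀ x ∈ Ioo a b, HasDerivAt z (A.mulVec (z x)) x)
    {s t : ℝ} (hs : s ∈ Icc a b) (ht : t ∈ Icc a b) :
    z t = (NormedSpace.exp (((t - s : ℝ) : ℂ) • A)).mulVec (z s) := by
  obtain ⟨E, hE⟩ : ∃ E : ℝ → Matrix (Fin 2) (Fin 2) ℂ,
      ∀ x, NormedSpace.exp (((-x : ℝ) : ℂ) • A) = E x := ⟨_, fun _ => rfl⟩
  have hexp : ∀ i j (x : ℝ), HasDerivAt (fun t : ℝ => E t i j) (-((E x * A) i j)) x := by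
    intro i j x
    have h1 := (hasDerivAt_exp_ofReal_smul_apply A i j (-x)).scomp x (hasDerivAt_neg x)
    rw [hE] at h1
    refine (h1.congr_deriv (neg_one_smul _ _)).congr_of_eventuallyEq
      (Eventually.of_forall fun t => ?_)
    simp only [← hE, Function.comp_apply]
  have hcont : ∀ i, Continuous fun x : ℝ => (E x).mulVec (z x) i := by
    intro i
    have h1 : ∀ j, Continuous fun t : ℝ => E t i j := fun j =>
      continuous_iff_continuousAt.2 fun x => (hexp i j x).continuousAt
    simp only [Matrix.mulVec, dotProduct, Fin.sum_univ_two]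
    exact ((h1 0).mul ((continuous_apply 0).comp hz)).add
      ((h1 1).mul ((continuous_apply 1).comp hz))
  -- With `E x = exp (-x A)`, the product `E z` has zero derivative inside the interval. Continuity
  -- alone carries its constancy to the endpoints, where `z` may fail to be differentiable.
  have hconst : ∀ x ∈ Icc a b, (E x).mulVec (z x) = (E a).mulVec (z a) := by
    intro x hx
    ext i
    have h1 := intervalIntegral.integral_eq_sub_of_hasDerivAt_of_le (f' := fun _ => 0) hx.1
      (hcont i).continuousOn (fun y hy => ?_) intervalIntegrable_const
    · simp only [intervalIntegral.integral_zero] at h1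
      exact (sub_eq_zero.1 h1.symm)
    · have hy' := hasDerivAt_pi.1 (hd y ⟨hy.1, hy.2.trans_le hx.2⟩)
      have h2 := ((hexp i 0 y).mul (hy' 0)).add ((hexp i 1 y).mul (hy' 1))
      simp only [Matrix.mulVec, dotProduct, Fin.sum_univ_two] at h2 ⊢
      refine h2.congr_deriv ?_
      simp only [Matrix.mul_apply, Fin.sum_univ_two]
      ring
  have hinv : ∀ x ∈ Icc a b, z x = (NormedSpace.exp ((x : ℂ) • A)).mulVec
      ((E a).mulVec (z a)) := by
    intro x hx
    rw [← hconst x hx, ← hE, Matrix.mulVec_mulVec, exp_smul_mul_exp_smul]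
    simp
  rw [hinv t ht, hinv s hs, ← hE]
  simp only [Matrix.mulVec_mulVec, exp_smul_mul_exp_smul]
  congr 3
  push_cast
  ring

theorem hasDerivAt_exp_ofReal_smul_mulVec (A : Matrix (Fin 2) (Fin 2) ℂ) (v : Fin 2 → ℂ) (x : ℝ) :
    HasDerivAt (fun t : ℝ => (NormedSpace.exp ((t : ℂ) • A)).mulVec v)
      (A.mulVec ((NormedSpace.exp ((x : ℂ) • A)).mulVec v)) x := by
  have hcomm : A * NormedSpace.exp ((x : ℂ) • A) = NormedSpace.exp ((x : ℂ) • A) * A := by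
    open scoped Matrix.Norms.Operator in
    exact (((Commute.refl A).smul_right (x : ℂ)).exp_right).eq
  rw [Matrix.mulVec_mulVec, hcomm, hasDerivAt_pi]
  intro i
  simp only [Matrix.mulVec, dotProduct, Fin.sum_univ_two]
  exact ((hasDerivAt_exp_ofReal_smul_apply A i 0 x).mul_const _).add
    ((hasDerivAt_exp_ofReal_smul_apply A i 1 x).mul_const _)

/-- Lagrange's identity with equal potentials, applied to the two columns of the exponential; at `0`
their Wronskian is `1`. -/
theorem det_exp_smul_coeffMatrix (c : ℝ) (lam : ℂ) (v h : ℝ) :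
    Complex.exp (c * h) * (NormedSpace.exp ((h : ℂ) • coeffMatrix c lam v)).det = 1 := by
  have hd := fun x => hasDerivAt_exp_mul_wedge
    (hasDerivAt_exp_ofReal_smul_mulVec (coeffMatrix c lam v) ![1, 0] x)
    (hasDerivAt_exp_ofReal_smul_mulVec (coeffMatrix c lam v) ![0, 1] x)
  have h1 := is_const_of_deriv_eq_zero (fun x => (hd x).differentiableAt)
    (fun x => by rw [(hd x).deriv]; ring) h 0
  simp only [wedge_mulVec] at h1
  simpa [wedge_eq] using h1

end ExpMidpoint

/-! ### Exactness of the exponential midpoint rule for the step potential -/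

section Numerical

variable {c : ℝ} {lam : ℂ} {φ : ℝ → ℝ} {h : ℝ} {N : ℕ} {z : ℝ → Fin 2 → ℂ}

/-- `z` is a continuous solution of the system with the piecewise constant potential. -/
structure IsStepSolution (c : ℝ) (lam : ℂ) (φ : ℝ → ℝ) (h : ℝ) (N : ℕ) (z : ℝ → Fin 2 → ℂ) :
    Prop where
  continuous : Continuous z
  hasDerivAt : ∀ k < 2 * N, ∀ x ∈ Ioo (node h N k) (node h N (k + 1)),
    HasDerivAt z ((coeffMatrix c lam (φ (node h N k + h / 2))).mulVec (z x)) x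

theorem IsStepSolution.node_succ (hz : IsStepSolution c lam φ h N z) (hh : 0 < h) {k : ℕ}
    (hk : k < 2 * N) : z (node h N (k + 1)) =
      (NormedSpace.exp ((h : ℂ) • coeffMatrix c lam (φ (node h N k + h / 2)))).mulVec
        (z (node h N k)) := by
  have hle : node h N k ≤ node h N (k + 1) := by rw [_root_.node_succ]; linarith
  have := eq_exp_smul_mulVec hz.continuous (hz.hasDerivAt k hk) (left_mem_Icc.2 hle)
    (right_mem_Icc.2 hle)
  rwa [_root_.node_succ, add_sub_cancel_left, ← _root_.node_succ] at this

theorem IsStepSolution.node_eq (hz : IsStepSolution c lam φ h N z) (hh : 0 < h) {k : ℕ}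
    (hk : k < 2 * N) : z (node h N k) =
      (NormedSpace.exp (((-h : ℝ) : ℂ) • coeffMatrix c lam (φ (node h N k + h / 2)))).mulVec
        (z (node h N (k + 1))) := by
  have hle : node h N k ≤ node h N (k + 1) := by rw [_root_.node_succ]; linarith
  have := eq_exp_smul_mulVec hz.continuous (hz.hasDerivAt k hk) (right_mem_Icc.2 hle)
    (left_mem_Icc.2 hle)
  rwa [show node h N k - node h N (k + 1) = -h by rw [_root_.node_succ]; ring] at this

/-- On each cell crossed backwards, the matrix used by the rule is the actual coefficient of the
equation for `z`, so no error is made. -/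
theorem expMidpoint_right_eq (hz : IsStepSolution c lam φ h N z) (hh : 0 < h) :
    ∀ k ≤ N, expMidpoint (fun ξ => coeffMatrix c lam (φ ξ)) (-h) (N * h) (z (N * h)) k
      = z (node h N (2 * N - k)) := by
  intro k
  induction k with
  | zero => intro _; rw [expMidpoint, tsub_zero, node_two_mul]
  | succ k ih =>
    intro hk
    rw [expMidpoint, ih (by omega), hz.node_eq hh (k := 2 * N - (k + 1)) (by omega)]
    rw [show 2 * N - (k + 1) + 1 = 2 * N - k by omega]
    congr 5
    simp only [node]
    rw [Nat.cast_sub (by omega)]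
    push_cast
    ring

/-- Forward steps multiply the numerical vector and `z` by the same matrix, hence their Wronskian by
its determinant `exp (-c h)`. The initial vector is arbitrary: the exact left solution enters only
through its value at `-L`. -/
theorem wedge_expMidpoint_left (hz : IsStepSolution c lam φ h N z) (hh : 0 < h) (y₀ : Fin 2 → ℂ) :
    ∀ k ≤ N, Complex.exp (c * (k * h)) *
      wedge (expMidpoint (fun ξ => coeffMatrix c lam (φ ξ)) h (-(N * h)) y₀ k)
        (z (node h N k)) = wedge y₀ (z (-(N * h))) := by
  intro k
  induction k with
  | zero => intro _; simp [expMidpoint, node_zero]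
  | succ k ih =>
    intro hk
    rw [← ih (by omega), expMidpoint, hz.node_succ hh (by omega)]
    have hn : -(N * h) + k * h + h / 2 = node h N k + h / 2 := rfl
    rw [hn, wedge_mulVec]
    have h1 := det_exp_smul_coeffMatrix c lam (φ (node h N k + h / 2)) h
    have h2 : Complex.exp (c * (((k + 1 : ℕ) : ℂ) * h))
        = Complex.exp (c * (k * h)) * Complex.exp (c * h) := by
      rw [← Complex.exp_add]; congr 1; push_cast; ring
    rw [h2]
    linear_combination (Complex.exp (c * (k * h)) * wedge (expMidpoint
      (fun ξ => coeffMatrix c lam (φ ξ)) h (-(N * h)) y₀ k) (z (node h N k))) * h1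

/-- The numerical Wronskian at `0` equals the one at `-L`, transported by Abel's formula. -/
theorem wedge_expMidpoint (hz : IsStepSolution c lam φ h N z) (hh : 0 < h) (y₀ : Fin 2 → ℂ) :
    wedge (expMidpoint (fun ξ => coeffMatrix c lam (φ ξ)) h (-(N * h)) y₀ N)
        (expMidpoint (fun ξ => coeffMatrix c lam (φ ξ)) (-h) (N * h) (z (N * h)) N)
      = Complex.exp (c * ((-(N * h) : ℝ) : ℂ)) * wedge y₀ (z (-(N * h))) := by
  rw [← wedge_expMidpoint_left hz hh y₀ N le_rfl, expMidpoint_right_eq hz hh N le_rfl,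
    show 2 * N - N = N by omega, ← mul_assoc, ← Complex.exp_add]
  simp

end Numerical

/-! ### Exponentially weighted integrals -/

section ExpWeight

variable {β : ℝ}

theorem integrable_exp_neg_mul_abs (hβ : 0 < β) :
    Integrable fun x : ℝ => Real.exp (-β * |x|) := by
  rw [← integrableOn_univ, ← Iic_union_Ioi (a := (0 : ℝ))]
  refine IntegrableOn.union ?_ ?_
  · refine (integrableOn_exp_mul_Iic hβ 0).congr_fun (fun x hx => ?_) measurableSet_Iic
    simp only [abs_of_nonpos (mem_Iic.1 hx)]
    ring_nf
  · refine (integrableOn_exp_mul_Ioi (by linarith : -β < 0) 0).congr_fun (fun x hx => ?_)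
      measurableSet_Ioi
    simp only [abs_of_pos (mem_Ioi.1 hx)]

theorem norm_intervalIntegral_le_integral {F : ℝ → ℂ} {g : ℝ → ℝ} {a b : ℝ} (hg : Integrable g)
    (hg0 : ∀ x, 0 ≤ g x) (h : ∀ x ∈ uIcc a b, ‖F x‖ ≤ g x) :
    ‖∫ x in a..b, F x‖ ≤ ∫ x, g x := by
  rw [intervalIntegral.norm_integral_eq_norm_integral_uIoc]
  refine (norm_integral_le_of_norm_le hg.integrableOn ((ae_restrict_iff' measurableSet_uIoc).2
    (Eventually.of_forall fun y hy => h y (uIoc_subset_uIcc hy)))).trans ?_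
  exact setIntegral_le_integral hg (Eventually.of_forall hg0)

/-- The total mass of the weight `exp (-β |x|)`. -/
noncomputable def expMass (β : ℝ) : ℝ := ∫ x : ℝ, Real.exp (-β * |x|)

theorem expMass_nonneg (β : ℝ) : 0 ≤ expMass β := integral_nonneg fun _ => (Real.exp_pos _).le

theorem norm_intervalIntegral_le_expMass {F : ℝ → ℂ} {a b M : ℝ} (hβ : 0 < β) (hM : 0 ≤ M)
    (h : ∀ x ∈ uIcc a b, ‖F x‖ ≤ M * Real.exp (-β * |x|)) :
    ‖∫ x in a..b, F x‖ ≤ M * expMass β := by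
  refine (norm_intervalIntegral_le_integral ((integrable_exp_neg_mul_abs hβ).const_mul M)
    (fun x => by positivity) h).trans (le_of_eq ?_)
  rw [integral_const_mul, expMass]

theorem exp_neg_mul_abs_le {x y : ℝ} (hβ : 0 < β) (hxy : |x - y| ≤ 1) :
    Real.exp (-β * |x|) ≤ Real.exp β * Real.exp (-β * |y|) := by
  rw [← Real.exp_add, Real.exp_le_exp]
  have := abs_sub_abs_le_abs_sub y x
  rw [abs_sub_comm] at this
  nlinarith

end ExpWeight

theorem intervalIntegrable_of_bound {F : ℝ → ℝ} {M : ℝ} (hm : Measurable F)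
    (hF : ∀ x, |F x| ≤ M) (a b : ℝ) : IntervalIntegrable F volume a b :=
  (intervalIntegrable_const (c := M)).mono_fun' hm.aestronglyMeasurable
    (Eventually.of_forall fun x => by simpa using hF x)

/-! ### A function near `1`, from the variation of its product with a large factor -/

/-- If `p d` varies by at most `T sup |p|` and `d` is large and nearly constant, then `p` is
nearly `1` as soon as it is nearly `1` at one point. -/
theorem norm_sub_one_le_of_mul_variation {p d : ℝ → ℂ} {s : Set ℝ} {S B T P : ℝ}
    (hp : ContinuousOn p s) (hs : IsCompact s)
    (hS : 1 ≤ S) (hB : 0 ≤ B) (hBS : 8 * B ≤ S ^ 2) (hT : 0 ≤ T) (hTS : 4 * T ≤ S) (hPS : P ≤ S)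
    (hd : ∀ x ∈ s, S / 2 ≤ ‖d x‖) (hdd : ∀ x ∈ s, ‖d x - d 0‖ ≤ 8 * B / S)
    (hp0 : ‖p 0 - 1‖ ≤ P / S)
    (hW : ∀ M, (∀ x ∈ s, ‖p x‖ ≤ M) → ∀ x ∈ s, ‖p x * d x - p 0 * d 0‖ ≤ M * T) :
    ∀ x ∈ s, ‖p x‖ ≤ 12 ∧ ‖p x - 1‖ ≤ (P + 32 * B + 24 * T) / S := by
  have hS0 : 0 < S := by linarith
  have hratio : ∀ x ∈ s, ‖d x - d 0‖ ≤ 16 * B / S ^ 2 * ‖d x‖ := fun x hx => by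
    have h1 : 8 * B / S = 16 * B / S ^ 2 * (S / 2) := by field_simp; ring
    exact (hdd x hx).trans (h1.le.trans (mul_le_mul_of_nonneg_left (hd x hx) (by positivity)))
  have h16 : 16 * B / S ^ 2 ≤ 2 := by rw [div_le_iff₀ (by positivity)]; linarith
  have hp0' : ‖p 0‖ ≤ 2 := by
    have h1 : P / S ≤ 1 := (div_le_one hS0).2 hPS
    have h2 := norm_add_le (p 0 - 1) 1
    rw [sub_add_cancel, norm_one] at h2
    linarith
  -- If `|p| ≤ D`, then `|p| |d| ≤ |p 0| |d 0| + D T`. Here `|p 0| ≤ 2`, `|d 0| ≤ 3 |d|` and `T ≤ S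
  -- / 4 ≤ |d| / 2`, so the bound improves to `6 + D / 2`. Compactness provides the first bound.
  have hbound : ∀ x ∈ s, ‖p x‖ ≤ 2 * 6 := by
    obtain ⟨M, hM⟩ := hs.exists_bound_of_continuousOn hp
    refine le_two_mul_of_forall_le_add_half hM fun D hD x hx => ?_
    have hD0 : 0 ≤ D := (norm_nonneg _).trans (hD x hx)
    have hdx := hd x hx
    have hdpos : 0 < ‖d x‖ := by linarith
    have h1 : ‖p x‖ * ‖d x‖ ≤ ‖p 0‖ * ‖d 0‖ + D * T := by
      rw [← norm_mul, ← norm_mul]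
      have := norm_add_le (p x * d x - p 0 * d 0) (p 0 * d 0)
      rw [sub_add_cancel] at this
      linarith [hW D hD x hx]
    have h2 : ‖d 0‖ ≤ 3 * ‖d x‖ := by
      have h3 := norm_sub_norm_le (d 0) (d x)
      rw [norm_sub_rev] at h3
      nlinarith [hratio x hx]
    have h4 : ‖p 0‖ * ‖d 0‖ ≤ 2 * (3 * ‖d x‖) :=
      mul_le_mul hp0' h2 (norm_nonneg _) (by norm_num)
    have h5 : D * T ≤ D / 2 * ‖d x‖ := by nlinarith
    have h6 : ‖p x‖ * ‖d x‖ ≤ (6 + D / 2) * ‖d x‖ := by linarith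
    exact le_of_mul_le_mul_right h6 hdpos
  norm_num at hbound
  intro x hx
  refine ⟨hbound x hx, ?_⟩
  have hdx := hd x hx
  have hdpos : 0 < ‖d x‖ := by linarith
  have h1 : (p x - 1) * d x
      = (p x * d x - p 0 * d 0) + (p 0 - 1) * d x - p 0 * (d x - d 0) := by ring
  have h2 : ‖p x - 1‖ * ‖d x‖ ≤ 12 * T + P / S * ‖d x‖ + 2 * (16 * B / S ^ 2 * ‖d x‖) := by
    rw [← norm_mul, h1]
    refine (norm_sub_le _ _).trans (add_le_add ((norm_add_le _ _).trans (add_le_add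
      (hW 12 hbound x hx) ?_)) ?_) <;> rw [norm_mul]
    · exact mul_le_mul_of_nonneg_right hp0 (norm_nonneg _)
    · exact mul_le_mul hp0' (hratio x hx) (norm_nonneg _) (by norm_num)
  have h3 : 12 * T ≤ 24 * T / S * ‖d x‖ := by
    rw [div_mul_eq_mul_div, le_div_iff₀ hS0]; nlinarith
  have h4 : 16 * B / S ^ 2 ≤ 16 * B / S :=
    div_le_div_of_nonneg_left (by positivity) hS0 (by nlinarith)
  have h5 : ‖p x - 1‖ * ‖d x‖ ≤ ((P + 32 * B + 24 * T) / S) * ‖d x‖ := by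
    have := mul_le_mul_of_nonneg_right h4 hdpos.le
    have h6 : (P + 32 * B + 24 * T) / S = P / S + 2 * (16 * B / S) + 24 * T / S := by ring
    rw [h6]
    nlinarith
  exact le_of_mul_le_mul_right h5 hdpos

/-! ### The midpoint defect against slowly varying functions -/

section MidpointQuadrature

variable {φ : ℝ → ℝ} {h : ℝ} {N : ℕ}

theorem sum_Ico_neg_eq_sum_range (F : ℤ → ℝ) (N : ℕ) :
    ∑ j ∈ Finset.Ico (-(N : ℤ)) (N : ℤ), F j = ∑ k ∈ Finset.range (2 * N), F ((k : ℤ) - N) := by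
  symm
  refine Finset.sum_nbij' (fun k => (k : ℤ) - N) (fun j => (j + N).toNat) ?_ ?_ ?_ ?_ ?_ <;>
    intro k hk <;> simp at hk ⊢ <;> omega

theorem sum_integral_cells {E : Type*} [NormedAddCommGroup E] [NormedSpace ℝ E]
    {F : ℝ → E} (hF : ∀ a b, IntervalIntegrable F volume a b) (h : ℝ) (N : ℕ) :
    ∑ k ∈ Finset.range (2 * N), ∫ x in node h N k..node h N (k + 1), F x
      = ∫ x in -(N * h)..N * h, F x := by
  rw [intervalIntegral.sum_integral_adjacent_intervals fun k _ => hF _ _, node_zero, node_two_mul]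

/-- Agreement is required on `Ico` because the floor in `stepPotential` makes the cells half-open on
the right; the missing endpoint is null. -/
theorem integral_congr_cell {E : Type*} [NormedAddCommGroup E] [NormedSpace ℝ E]
    {F G : ℝ → E} {a b : ℝ} (hab : a ≤ b) (hFG : ∀ x ∈ Ico a b, F x = G x) :
    ∫ x in a..b, F x = ∫ x in a..b, G x := by
  rw [intervalIntegral.integral_of_le hab, intervalIntegral.integral_of_le hab,
    ← integral_Ico_eq_integral_Ioc, ← integral_Ico_eq_integral_Ioc]
  exact setIntegral_congr_fun measurableSet_Ico hFG

theorem node_le_succ (hh : 0 < h) (N k : ℕ) : node h N k ≤ node h N (k + 1) := by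
  rw [node_succ]; linarith

theorem midpointQuadError_eq_sum (hφ : ∀ a b, IntervalIntegrable φ volume a b) (h : ℝ)
    (N : ℕ) : midpointQuadError φ h N = ∑ k ∈ Finset.range (2 * N),
      ∫ x in node h N k..node h N (k + 1), (φ (node h N k + h / 2) - φ x) := by
  rw [midpointQuadError, sum_Ico_neg_eq_sum_range (fun j => φ ((j : ℝ) * h + h / 2)),
    ← sum_integral_cells hφ, Finset.mul_sum, ← Finset.sum_sub_distrib]
  refine Finset.sum_congr rfl fun k _ => ?_
  rw [intervalIntegral.integral_sub intervalIntegrable_const (hφ _ _),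
    intervalIntegral.integral_const, node_succ, add_sub_cancel_left, smul_eq_mul]
  congr 3
  simp only [node]
  push_cast
  ring

theorem midpointQuadError_eq_integral (hφ : ∀ a b, IntervalIntegrable φ volume a b)
    (hs : ∀ a b, IntervalIntegrable (stepPotential φ h N) volume a b) (hh : 0 < h) :
    midpointQuadError φ h N = ∫ x in -(N * h)..N * h, (stepPotential φ h N x - φ x) := by
  rw [midpointQuadError_eq_sum hφ, ← sum_integral_cells fun a b => (hs a b).sub (hφ a b)]
  refine Finset.sum_congr rfl fun k hk => integral_congr_cell (node_le_succ hh N k) fun x hx => ?_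
  rw [stepPotential_of_mem hh (Finset.mem_range.1 hk) hx]

/-- On one cell the midpoint defect integrated against a slowly varying function is `O(h ^ 2)`. -/
theorem norm_integral_cell_mul_le {φ' φ'' : ℝ → ℝ} {g g' : ℝ → ℂ} {a C γ G : ℝ} (hγ : 0 < γ)
    (hh : 0 < h) (hh1 : h ≤ 1) (hφ : ∀ x, HasDerivAt φ (φ' x) x)
    (hφ' : ∀ x, HasDerivAt φ' (φ'' x) x)
    (hC : ∀ x, |φ' x| ≤ C * Real.exp (-γ * |x|)) (hC' : ∀ x, |φ'' x| ≤ C * Real.exp (-γ * |x|))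
    (hgc : Continuous g) (hg : ∀ x ∈ Icc a (a + h), HasDerivAt g (g' x) x)
    (hG : ∀ x ∈ Icc a (a + h), ‖g x‖ ≤ G)
    (hG' : ∀ x ∈ Icc a (a + h), ‖g' x‖ ≤ G) :
    ‖∫ x in a..a + h, ((φ (a + h / 2) - φ x : ℝ) : ℂ) * g x‖
      ≤ 2 * (C * Real.exp γ) * G * h ^ 2 * ∫ x in a..a + h, Real.exp (-γ * |x|) := by
  have hC0 : 0 ≤ C := by
    have := (abs_nonneg _).trans (hC 0)
    simpa using this
  have hm : a + h / 2 ∈ Icc a (a + h) := ⟨by linarith, by linarith⟩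
  have hG0 : 0 ≤ G := (norm_nonneg _).trans (hG _ hm)
  have hdist : ∀ x ∈ Icc a (a + h), ∀ y ∈ Icc a (a + h), |x - y| ≤ h := fun x hx y hy => by
    rw [abs_le]; constructor <;> linarith [hx.1, hx.2, hy.1, hy.2]
  have hφc : Continuous φ := continuous_iff_continuousAt.2 fun x => (hφ x).continuousAt
  set m := a + h / 2 with hm_def
  have hw : ∀ x ∈ Icc a (a + h), ∀ y ∈ Icc a (a + h),
      C * Real.exp (-γ * |y|) ≤ C * Real.exp γ * Real.exp (-γ * |x|) := fun x hx y hy => by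
    rw [mul_assoc]
    exact mul_le_mul_of_nonneg_left
      (exp_neg_mul_abs_le hγ ((hdist y hy x hx).trans hh1)) hC0
  have hseg : ∀ x ∈ Icc a (a + h), segment ℝ m x ⊆ Icc a (a + h) := fun x hx =>
    (convex_Icc a (a + h)).segment_subset hm hx
  have hd1 : ∀ x ∈ Icc a (a + h), |φ m - φ x| ≤ C * Real.exp γ * Real.exp (-γ * |x|) * h :=
    fun x hx => by
    have := (convex_Icc a (a + h)).norm_image_sub_le_of_norm_hasDerivWithin_le
      (f := φ) (f' := φ') (C := C * Real.exp γ * Real.exp (-γ * |x|))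
      (fun y _ => (hφ y).hasDerivWithinAt) (fun y hy => (hC y).trans (hw x hx y hy)) hx hm
    exact this.trans (mul_le_mul_of_nonneg_left (hdist m hm x hx) (by positivity))
  have hd2 : ∀ x ∈ Icc a (a + h),
      |φ m - φ x + φ' m * (x - m)| ≤ C * Real.exp γ * Real.exp (-γ * |x|) * h ^ 2 :=
    fun x hx => by
    have h1 : ∀ y ∈ Icc a (a + h),
        ‖φ' m - φ' y‖ ≤ C * Real.exp γ * Real.exp (-γ * |x|) * h := fun y hy => by
      have := (convex_Icc a (a + h)).norm_image_sub_le_of_norm_hasDerivWithin_le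
        (f := φ') (f' := φ'') (C := C * Real.exp γ * Real.exp (-γ * |x|))
        (fun y _ => (hφ' y).hasDerivWithinAt) (fun y hy => (hC' y).trans (hw x hx y hy)) hy hm
      exact this.trans (mul_le_mul_of_nonneg_left (hdist m hm y hy) (by positivity))
    have h2 : ∀ y ∈ Icc a (a + h), HasDerivWithinAt (fun y => φ m - φ y + φ' m * (y - m))
        (φ' m - φ' y) (Icc a (a + h)) y := fun y _ => by
      refine (((hφ y).const_sub (φ m)).add
        (((hasDerivAt_id y).sub_const m).const_mul (φ' m))).hasDerivWithinAt.congr_deriv ?_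
      simp; ring
    have := (convex_Icc a (a + h)).norm_image_sub_le_of_norm_hasDerivWithin_le h2 h1 hm hx
    simp only [sub_self, mul_zero, add_zero, sub_zero] at this
    refine this.trans ?_
    rw [sq, ← mul_assoc]
    exact mul_le_mul_of_nonneg_left (hdist x hx m hm) (by positivity)
  have hd3 : ∀ x ∈ Icc a (a + h), ‖g x - g m‖ ≤ G * h := fun x hx => by
    have := (convex_Icc a (a + h)).norm_image_sub_le_of_norm_hasDerivWithin_le
      (f := g) (f' := g') (C := G) (fun y hy => (hg y hy).hasDerivWithinAt) hG' hm hx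
    exact this.trans (mul_le_mul_of_nonneg_left (hdist x hx m hm) hG0)
  -- The linear part of the defect is odd about the midpoint. This is the cancellation that gives
  -- second order.
  have hlin : ∫ x in a..a + h, ((φ' m * (x - m) : ℝ) : ℂ) * g m = 0 := by
    rw [intervalIntegral.integral_mul_const, intervalIntegral.integral_ofReal,
      intervalIntegral.integral_const_mul, intervalIntegral.integral_sub
        intervalIntegral.intervalIntegrable_id intervalIntegrable_const, integral_id,
      intervalIntegral.integral_const]
    have : ((a + h) ^ 2 - a ^ 2) / 2 - (a + h - a) • m = 0 := by
      rw [hm_def, smul_eq_mul]; ring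
    rw [this]
    simp
  -- After freezing `g` at the midpoint and adding the linear term of zero integral, each product
  -- has size `h ^ 2`: first order in the defect times first order in `g`, and second order in the
  -- corrected defect.
  have hsplit : ∫ x in a..a + h, ((φ m - φ x : ℝ) : ℂ) * g x
      = ∫ x in a..a + h, (((φ m - φ x : ℝ) : ℂ) * (g x - g m)
        + ((φ m - φ x + φ' m * (x - m) : ℝ) : ℂ) * g m) := by
    rw [← sub_eq_zero, ← intervalIntegral.integral_sub
      (Continuous.intervalIntegrable (by fun_prop) _ _)
      (Continuous.intervalIntegrable (by fun_prop) _ _), ← neg_eq_zero,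
      ← intervalIntegral.integral_neg, ← hlin]
    refine intervalIntegral.integral_congr fun x _ => ?_
    push_cast
    ring
  rw [hsplit, ← intervalIntegral.integral_const_mul]
  refine intervalIntegral.norm_integral_le_of_norm_le (by linarith)
    (Eventually.of_forall fun x hx => ?_) (Continuous.intervalIntegrable (by fun_prop) _ _)
  have hx' : x ∈ Icc a (a + h) := Ioc_subset_Icc_self hx
  have h1 : ‖((φ m - φ x : ℝ) : ℂ) * (g x - g m)‖
      ≤ C * Real.exp γ * Real.exp (-γ * |x|) * h * (G * h) := by
    rw [norm_mul, Complex.norm_real]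
    exact mul_le_mul (hd1 x hx') (hd3 x hx') (norm_nonneg _) (by positivity)
  have h2 : ‖((φ m - φ x + φ' m * (x - m) : ℝ) : ℂ) * g m‖
      ≤ C * Real.exp γ * Real.exp (-γ * |x|) * h ^ 2 * G := by
    rw [norm_mul, Complex.norm_real]
    exact mul_le_mul (hd2 x hx') (hG m hm) (norm_nonneg _) (by positivity)
  refine (norm_add_le _ _).trans ((add_le_add h1 h2).trans (le_of_eq ?_))
  ring

/-- The midpoint defect integrated against a slowly varying function is `O(h ^ 2)`. -/
theorem norm_integral_stepPotential_sub_mul_le {φ' φ'' : ℝ → ℝ} {g g' : ℝ → ℂ} {C γ G : ℝ}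
    (hγ : 0 < γ) (hh : 0 < h) (hh1 : h ≤ 1) (hφ : ∀ x, HasDerivAt φ (φ' x) x)
    (hφ' : ∀ x, HasDerivAt φ' (φ'' x) x)
    (hC : ∀ x, |φ' x| ≤ C * Real.exp (-γ * |x|)) (hC' : ∀ x, |φ'' x| ≤ C * Real.exp (-γ * |x|))
    (hs : ∀ a b, IntervalIntegrable (stepPotential φ h N) volume a b)
    (hgc : Continuous g) (hg : ∀ x ∈ Icc (-(N * h)) (N * h), HasDerivAt g (g' x) x)
    (hG : ∀ x ∈ Icc (-(N * h)) (N * h), ‖g x‖ ≤ G)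
    (hG' : ∀ x ∈ Icc (-(N * h)) (N * h), ‖g' x‖ ≤ G) :
    ‖∫ x in -(N * h)..N * h, ((stepPotential φ h N x - φ x : ℝ) : ℂ) * g x‖
      ≤ 2 * (C * Real.exp γ) * G * h ^ 2 * expMass γ := by
  have hC0 : 0 ≤ C := by
    have := (abs_nonneg _).trans (hC 0)
    simpa using this
  have hNh : 0 ≤ N * h := by positivity
  have hG0 : 0 ≤ G := (norm_nonneg _).trans (hG 0 ⟨by linarith, hNh⟩)
  have hφc : Continuous φ := continuous_iff_continuousAt.2 fun x => (hφ x).continuousAt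
  have hint : ∀ a b, IntervalIntegrable
      (fun x => ((stepPotential φ h N x - φ x : ℝ) : ℂ) * g x) volume a b := fun a b =>
    have := (hs a b).sub (hφc.intervalIntegrable a b)
    IntervalIntegrable.mul_continuousOn ⟨this.1.ofReal, this.2.ofReal⟩ hgc.continuousOn
  rw [← sum_integral_cells hint]
  have hcell : ∀ k ∈ Finset.range (2 * N),
      ‖∫ x in node h N k..node h N (k + 1), ((stepPotential φ h N x - φ x : ℝ) : ℂ) * g x‖
      ≤ 2 * (C * Real.exp γ) * G * h ^ 2 *
        ∫ x in node h N k..node h N (k + 1), Real.exp (-γ * |x|) := by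
    intro k hk
    have hk' := Finset.mem_range.1 hk
    have hsub : Icc (node h N k) (node h N k + h) ⊆ Icc (-(N * h)) (N * h) := by
      have h1 : (k : ℝ) + 1 ≤ 2 * N := by exact_mod_cast hk'
      have h0 : (0 : ℝ) ≤ k := Nat.cast_nonneg k
      refine Icc_subset_Icc ?_ ?_ <;> simp only [node] <;> nlinarith
    rw [integral_congr_cell (node_le_succ hh N k) (fun x hx => by
      rw [stepPotential_of_mem hh hk' hx]), node_succ]
    exact norm_integral_cell_mul_le hγ hh hh1 hφ hφ' hC hC' hgc (fun x hx => hg x (hsub hx))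
      (fun x hx => hG x (hsub hx)) (fun x hx => hG' x (hsub hx))
  refine (norm_sum_le_of_le _ hcell).trans ?_
  rw [← Finset.mul_sum, sum_integral_cells fun a b => Continuous.intervalIntegrable (by fun_prop) a b]
  refine mul_le_mul_of_nonneg_left ?_ (by positivity)
  rw [intervalIntegral.integral_of_le (by linarith)]
  exact setIntegral_le_integral (integrable_exp_neg_mul_abs hγ)
    (Eventually.of_forall fun x => (Real.exp_pos _).le)

end MidpointQuadrature

/-! ### The error of the numerical Evans function as an integral -/

section EvansProduct

variable {f uh : ℝ → ℝ} {c um up : ℝ} {lam : ℂ} {B β S h : ℝ} {N : ℕ}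

/-- The difference of the squares does not depend on `lam`, while the sum of the roots has real part
at least `2 S`. -/
theorem norm_evansKappa_sub_le {u v : ℝ} (hS : 0 < S) (hu : S ≤ (evansKappa f c u lam).re)
    (hv : S ≤ (evansKappa f c v lam).re) (huv : |deriv f u - deriv f v| ≤ 2 * B) :
    ‖evansKappa f c u lam - evansKappa f c v lam‖ ≤ 4 * B / S := by
  have h1 : (evansKappa f c u lam - evansKappa f c v lam)
      * (evansKappa f c u lam + evansKappa f c v lam)
      = ((4 * (deriv f v - deriv f u) : ℝ) : ℂ) := by
    push_cast
    linear_combination evansKappa_sq f c u lam - evansKappa_sq f c v lam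
  have h2 : 2 * S ≤ ‖evansKappa f c u lam + evansKappa f c v lam‖ := by
    refine le_trans ?_ (Complex.re_le_norm _)
    rw [Complex.add_re]; linarith
  have h3 := congrArg norm h1
  rw [norm_mul, Complex.norm_real, Real.norm_eq_abs, abs_mul, abs_sub_comm,
    abs_of_pos (by norm_num : (0 : ℝ) < 4)] at h3
  rw [le_div_iff₀ hS]
  have h4 := mul_le_mul_of_nonneg_left h2
    (norm_nonneg (evansKappa f c u lam - evansKappa f c v lam))
  linarith

/-- The standing assumptions on the potential: it converges to its limits at rate `2 β`, with
total deviation at most `B`. -/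
structure TwoSidedDecay (φ : ℝ → ℝ) (lm lp B β : ℝ) : Prop where
  continuous : Continuous φ
  pos : 0 < B
  rate_pos : 0 < β
  right : RightDecay φ lp B (2 * β)
  left : RightDecay (fun x => φ (-x)) lm B (2 * β)

theorem TwoSidedDecay.abs_sub_le {φ : ℝ → ℝ} {lm lp : ℝ} (h : TwoSidedDecay φ lm lp B β) :
    |lm - lp| ≤ 2 * B := by
  have h1 := h.right.bound 0
  have h2 := h.left.bound 0
  simp only [neg_zero] at h2
  have := _root_.abs_sub_le lm (φ 0) lp
  rw [abs_sub_comm lm (φ 0)] at this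
  linarith

theorem TwoSidedDecay.existsUnique_right (hφ : TwoSidedDecay (wavePotential f uh) (deriv f um)
      (deriv f up) B β) (hS : 0 < S) (hBS : 8 * B ≤ S ^ 2)
    (hκ : S ≤ (evansKappa f c up lam).re) : ∃! y, IsRightEvansSolution f c up uh lam y :=
  existsUnique_isRightEvansSolution hφ.pos (by linarith [hφ.rate_pos] : 0 < 2 * β) hφ.continuous
    hφ.right hS hBS hκ

theorem TwoSidedDecay.existsUnique_left (hφ : TwoSidedDecay (wavePotential f uh) (deriv f um)
      (deriv f up) B β) (hS : 0 < S) (hBS : 8 * B ≤ S ^ 2)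
    (hκ : S ≤ (evansKappa f c um lam).re) : ∃! y, IsLeftEvansSolution f c um uh lam y :=
  existsUnique_isLeftEvansSolution (existsUnique_isRightEvansSolution hφ.pos
    (by linarith [hφ.rate_pos] : 0 < 2 * β) (hφ.continuous.comp continuous_neg)
    hφ.left hS hBS (by rwa [evansKappa_neg]))

/-- The product `exp (c x) u₋(x) ũ₊(x)` of the exact left solution and of the right solution for
the piecewise constant potential represents the error of the numerical Evans function, and it is
close to `1` together with its derivative. -/
theorem exists_evansProduct (hφ : TwoSidedDecay (wavePotential f uh) (deriv f um) (deriv f up) B β)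
    (hS : 1 ≤ S) (hBS : 8 * B ≤ S ^ 2) (hTS : 4 * (2 * B * expMass β) ≤ S)
    (hPS : 12 * B / β ≤ S)
    (hκm : S ≤ (evansKappa f c um lam).re) (hκp : S ≤ (evansKappa f c up lam).re)
    (hh : 0 < h) (N : ℕ) :
    ∃ p p' : ℝ → ℂ, (∀ x, HasDerivAt p (p' x) x) ∧
      evansNumerical f c um up uh lam h N - evansFunction f c um up uh lam
        = ∫ x in -(N * h)..N * h, ((stepPotential (wavePotential f uh) h N x
            - wavePotential f uh x : ℝ) : ℂ) * p x ∧
      (∀ x ∈ Icc (-(N * h)) (N * h),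
        ‖p x - 1‖ ≤ (12 * B / β + 32 * B + 24 * (2 * B * expMass β)) / S) ∧
      (∀ x ∈ Icc (-(N * h)) (N * h), ‖p' x‖ ≤ 72 * B / S) := by
  obtain ⟨hφc, hB, hβ, hr, hl⟩ := hφ
  have hφ : TwoSidedDecay (wavePotential f uh) (deriv f um) (deriv f up) B β :=
    ⟨hφc, hB, hβ, hr, hl⟩
  have hS0 : 0 < S := by linarith
  have hL : 0 ≤ N * h := by positivity
  set φ := wavePotential f uh with hφ_def
  set φs := stepPotential φ h N with hφs_def
  have hsr : RightDecay φs (deriv f up) B β := rightDecay_stepPotential hh hβ hr N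
  have hκm' : S ≤ (evansKappa f (-c) um lam).re := by rwa [evansKappa_neg]
  -- Three Riccati solutions: `δ` for the step potential, `δe` for the exact potential on the right,
  -- and `η` for the exact reflected potential, which yields the left solution.
  obtain ⟨δ, hδ⟩ := exists_isRiccati hS0 hκp hB hBS (hsr.measurable.sub_const _) hsr.bound
  obtain ⟨δe, hδe⟩ := exists_isRiccati hS0 hκp hB hBS (hr.measurable.sub_const _) hr.bound
  obtain ⟨η, hη⟩ := exists_isRiccati hS0 hκm' hB hBS (hl.measurable.sub_const _) hl.bound
  have hδb := hδ.norm_le_exp hS0 hκp hB hBS hβ hsr.decay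
  have hδi := integrableOn_Ioi_zero_of_decay hβ hδ.continuous hδb
  have hηb := hη.norm_le_exp hS0 hκm' hB hBS hβ (hl.mono (β' := β) (by linarith)).decay
  have hηi := integrableOn_Ioi_zero_of_decay hβ hη.continuous hηb
  set μ := evansMu₂ f c up lam with hμ_def
  set ν := evansMu₂ f (-c) um lam with hν_def
  have hμκ : evansKappa f c up lam + 2 * μ = -c := evansKappa_add_two_mul_evansMu₂
  have hνκ : evansKappa f c um lam + 2 * ν = c := by
    have := evansKappa_add_two_mul_evansMu₂ (f := f) (c := -c) (u₀ := um) (lam := lam)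
    rw [evansKappa_neg] at this
    rw [this]; simp
  have hR : IsRightEvansSolution f c up uh lam (jostVector μ δe) :=
    isRightEvansSolution_jostVector hB (by linarith : 0 < 2 * β) hφc hr hS0 hBS hκp hδe
  have hLv : IsRightEvansSolution f (-c) um (fun x => uh (-x)) lam (jostVector ν η) :=
    isRightEvansSolution_jostVector hB (by linarith : 0 < 2 * β)
      (hφc.comp continuous_neg) hl hS0 hBS hκm' hη
  have hLs : IsLeftEvansSolution f c um uh lam (reflect (jostVector ν η)) :=
    isLeftEvansSolution_reflect hLv
  have hRe := evansRight_eq (hφ.existsUnique_right hS0 hBS hκp) hR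
  have hLe := evansLeft_eq (hφ.existsUnique_left hS0 hBS hκm) hLs
  set z := jostVector μ δ with hz_def
  set y := reflect (jostVector ν η) with hy_def
  have hz0 : ∀ x, HasDerivAt (fun t => z t 0) ((μ + δ x) * z x 0) x := fun x =>
    hasDerivAt_jostVector_zero hδ.continuous hδi x
  have hy0 : ∀ x, HasDerivAt (fun t => y t 0) (-(ν + η (-x)) * y x 0) x := fun x => by
    have h1 := (hasDerivAt_jostVector_zero (μ := ν) hη.continuous hηi (-x)).scomp x
      (hasDerivAt_neg x)
    refine h1.congr_deriv ?_
    simp [hy_def, reflect, jostVector]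
    ring
  have hz1 : ∀ x, z x 1 = (μ + δ x) * z x 0 := fun x => by simp [hz_def, jostVector]
  have hy1 : ∀ x, y x 1 = -(ν + η (-x)) * y x 0 := fun x => by
    simp [hy_def, reflect, jostVector]
    ring
  have hzc : Continuous z := continuous_jostVector hδ.continuous hδi
  have hyc : Continuous y := continuous_iff_continuousAt.2 fun x => (hLs.1 x).continuousAt
  have hstep : IsStepSolution c lam φ h N z := by
    refine ⟨hzc, fun k hk x hx => ?_⟩
    have hev := stepPotential_eventuallyEq (φ := φ) hh hk hx
    have hca : ContinuousAt (fun x => φs x - deriv f up) x :=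
      (continuousAt_const.congr hev.symm).sub continuousAt_const
    have hd := hδ.hasDerivAt (hS0.trans_le hκp) (hsr.measurable.sub_const _) hsr.bound hca
    have h1 := hasDerivAt_jostVector hδ.continuous hδi hd hμκ evansMu₂_sq_add
    rw [add_sub_cancel, hφs_def, hev.eq_of_nhds] at h1
    exact h1
  -- The Riccati solution at `x` depends only on the potential beyond `x`, and both potentials agree
  -- on `[L, ∞)`. Hence the exact starting value at `L` is also the value of `z`.
  have hzL : jostVector μ δe (N * h) = z (N * h) := by
    have h1 : ∀ x, N * h ≤ x → δe x = δ x :=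
      hδe.eq_of_eqOn hδ hS0 hκp hBS (hr.measurable.sub_const _) hr.bound
        (hsr.measurable.sub_const _) hsr.bound fun x hx => by
          rw [hφs_def, stepPotential_of_ge hx]
    simp only [hz_def, jostVector, tailExp_congr h1, h1 _ le_rfl]
  set W : ℝ → ℂ := fun x => Complex.exp (c * x) * wedge (y x) (z x) with hW_def
  have hnum : evansNumerical f c um up uh lam h N = W (-(N * h)) := by
    rw [evansNumerical, hLe, hRe, hzL]
    exact wedge_expMidpoint hstep hh _
  have hfun : evansFunction f c um up uh lam = W (N * h) := by
    have hd := fun x => hasDerivAt_exp_mul_wedge (hLs.1 x) (hR.1 x)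
    have h1 := is_const_of_deriv_eq_zero (fun x => (hd x).differentiableAt)
      (fun x => by rw [(hd x).deriv]; ring) 0 (N * h)
    rw [evansFunction, hLe, hRe, hW_def]
    simp only [hzL] at h1
    simpa using h1
  set p : ℝ → ℂ := fun x => Complex.exp (c * x) * (y x 0 * z x 0) with hp_def
  -- `d` is the difference of the logarithmic derivatives of `z` and of the left solution, hence `W
  -- = p d`. Its leading part `μ + ν` is minus the mean of the two `κ`.
  set d : ℝ → ℂ := fun x => μ + ν + δ x + η (-x) with hd_def
  have hWp : ∀ x, W x = p x * d x := fun x => by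
    simp only [hW_def, hp_def, hd_def, wedge_eq, hz1, hy1]; ring
  have hpd : ∀ x, HasDerivAt p (p x * (c + μ - ν + δ x - η (-x))) x := fun x => by
    refine ((hasDerivAt_exp_ofReal_mul c x).mul ((hy0 x).mul (hz0 x))).congr_deriv ?_
    simp only [hp_def, Pi.mul_apply]; ring
  have hpc : Continuous p := continuous_iff_continuousAt.2 fun x => (hpd x).continuousAt
  have hWc : Continuous W := by
    have := hδ.continuous
    have := hη.continuous
    rw [funext hWp]
    fun_prop
  have hqb : ∀ x, |φs x - φ x| ≤ 2 * B * Real.exp (-β * |x|) :=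
    abs_stepPotential_sub_le hh hβ hr hl N
  have hqi : ∀ a b, IntervalIntegrable (fun x => ((φs x - φ x : ℝ) : ℂ) * p x) volume a b :=
    fun a b => by
    have := intervalIntegrable_of_bound (M := 2 * B) (hsr.measurable.sub hφc.measurable)
      (fun x => (hqb x).trans (by
        have : Real.exp (-β * |x|) ≤ 1 := Real.exp_le_one_iff.2 (by
          nlinarith [abs_nonneg x])
        nlinarith)) a b
    exact IntervalIntegrable.mul_continuousOn ⟨this.1.ofReal, this.2.ofReal⟩ hpc.continuousOn
  -- `W` is continuous everywhere, and Lagrange's identity gives its derivative off the nodes, a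
  -- countable set.
  have hftc : ∀ a ∈ Icc (-(N * h)) (N * h), ∀ b ∈ Icc (-(N * h)) (N * h),
      ∫ x in a..b, ((φs x - φ x : ℝ) : ℂ) * p x = W a - W b := by
    intro a ha b hb
    have h1 := integral_eq_of_hasDerivAt_off_countable W
      (fun x => -(((φs x - φ x : ℝ) : ℂ) * p x)) (s := range (node h N)) (a := a) (b := b)
      (countable_range _) hWc.continuousOn ?_ (hqi a b).neg
    · rw [intervalIntegral.integral_neg] at h1
      linear_combination -h1
    · rintro x ⟨hx, hx'⟩
      have hxL : x ∈ Ioo (-(N * h)) (N * h) :=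
        ⟨(le_min ha.1 hb.1).trans_lt hx.1, hx.2.trans_le (max_le ha.2 hb.2)⟩
      obtain ⟨k, hk, hxk⟩ := exists_mem_cell hh hxL hx'
      refine (hasDerivAt_exp_mul_wedge (hLs.1 x) (hstep.hasDerivAt k hk x hxk)).congr_deriv ?_
      rw [hφs_def, stepPotential_of_mem hh hk (Ioo_subset_Ico_self hxk), ← hφ_def]
      simp only [hp_def]
      push_cast
      ring
  have hδ2 : ∀ x, ‖δ x‖ ≤ 2 * B / S := hδ.bound
  have hη2 : ∀ x, ‖η x‖ ≤ 2 * B / S := hη.bound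
  have hBS' : 4 * B / S ≤ S / 2 := by rw [div_le_div_iff₀ hS0 two_pos]; nlinarith
  have hdlow : ∀ x, S / 2 ≤ ‖d x‖ := fun x => by
    have h1 : S ≤ ‖μ + ν‖ := by
      have h2 : μ + ν = -((evansKappa f c up lam + evansKappa f c um lam) / 2) := by
        linear_combination (1 / 2 : ℂ) * hμκ + (1 / 2 : ℂ) * hνκ
      rw [h2, norm_neg]
      refine le_trans ?_ (Complex.re_le_norm _)
      have h3 : ((evansKappa f c up lam + evansKappa f c um lam) / 2).re
          = ((evansKappa f c up lam).re + (evansKappa f c um lam).re) / 2 := by simp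
      rw [h3]; linarith
    have h2 : μ + ν = d x - (δ x + η (-x)) := by simp only [hd_def]; ring
    have h3 := norm_sub_le (d x) (δ x + η (-x))
    have h4 := norm_add_le (δ x) (η (-x))
    rw [h2] at h1
    have h5 : 4 * B / S = 2 * B / S + 2 * B / S := by ring
    linarith [hδ2 x, hη2 (-x)]
  have hdd : ∀ x, ‖d x - d 0‖ ≤ 8 * B / S := fun x => by
    have h1 : d x - d 0 = (δ x - δ 0) + (η (-x) - η 0) := by
      simp only [hd_def, neg_zero]; ring
    rw [h1]
    have h2 := norm_add_le (δ x - δ 0) (η (-x) - η 0)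
    have h3 := norm_sub_le (δ x) (δ 0)
    have h4 := norm_sub_le (η (-x)) (η 0)
    have h5 : 8 * B / S = 2 * B / S + 2 * B / S + (2 * B / S + 2 * B / S) := by ring
    linarith [hδ2 x, hη2 (-x), hδ2 0, hη2 0]
  -- At `0` all exponential factors equal `1`, and `p 0` is the product of two tail exponentials,
  -- each within `4 B / (β S) ≤ 1` of `1`.
  have hp0 : ‖p 0 - 1‖ ≤ 12 * B / β / S := by
    have hb : 2 * B / S ≤ β := by
      rw [div_le_iff₀ hβ] at hPS
      rw [div_le_iff₀ hS0]; linarith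
    have h1 := norm_tailExp_zero_sub_one_le hβ hδb hb
    have h2 := norm_tailExp_zero_sub_one_le hβ hηb hb
    have h3 : p 0 - 1 = (tailExp η 0 - 1) * (tailExp δ 0 - 1) + (tailExp η 0 - 1)
        + (tailExp δ 0 - 1) := by
      simp only [hp_def, hy_def, hz_def, reflect, jostVector]
      simp
      ring
    have h4 : 2 * (2 * B / S / β) ≤ 1 := by
      rw [div_div, mul_div_assoc', div_le_one (by positivity)]
      rw [div_le_iff₀ hβ] at hPS
      linarith
    have h5 : ‖(tailExp η 0 - 1) * (tailExp δ 0 - 1)‖ ≤ 1 * (2 * (2 * B / S / β)) := by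
      rw [norm_mul]
      exact mul_le_mul (h2.trans h4) h1 (norm_nonneg _) zero_le_one
    rw [h3]
    refine (norm_add₃_le ..).trans ((add_le_add (add_le_add h5 h2) h1).trans (le_of_eq ?_))
    field_simp
    ring
  have hnear := norm_sub_one_le_of_mul_variation (p := p) (d := d) (T := 2 * B * expMass β)
    (P := 12 * B / β) hpc.continuousOn (isCompact_Icc (a := -(N * h)) (b := N * h)) hS hB.le hBS
    (mul_nonneg (by positivity) (expMass_nonneg β)) hTS hPS (fun x _ => hdlow x)
    (fun x _ => hdd x) hp0 (by
      intro M hM x hx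
      have h0 : (0 : ℝ) ∈ Icc (-(N * h)) (N * h) := ⟨by linarith, hL⟩
      have hM0 : 0 ≤ M := (norm_nonneg _).trans (hM 0 h0)
      rw [← hWp, ← hWp, ← hftc x hx 0 h0]
      refine (norm_intervalIntegral_le_expMass (M := M * (2 * B)) hβ (by positivity)
        fun t ht => ?_).trans (le_of_eq (by ring))
      have ht' : t ∈ Icc (-(N * h)) (N * h) := (convex_Icc _ _).ordConnected.uIcc_subset hx h0 ht
      rw [norm_mul, Complex.norm_real, mul_comm, mul_assoc]
      exact mul_le_mul (hM t ht') (hqb t) (norm_nonneg _) hM0)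
  refine ⟨p, _, hpd, ?_, fun x hx => (hnear x hx).2, fun x hx => ?_⟩
  · rw [hnum, hfun]
    exact (hftc _ ⟨le_rfl, by linarith⟩ _ ⟨by linarith, le_rfl⟩).symm
  -- In the logarithmic derivative of `p` the large parts cancel down to `(κ₋ - κ₊) / 2`, which is
  -- `O(1 / S)`. With `|p| ≤ 12` this gives `72 B / S = 12 * (6 B / S)`.
  · have h1 : (c : ℂ) + μ - ν + δ x - η (-x)
        = (evansKappa f c um lam - evansKappa f c up lam) / 2 + δ x - η (-x) := by
      linear_combination (1 / 2 : ℂ) * hμκ - (1 / 2 : ℂ) * hνκ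
    have h2 := norm_evansKappa_sub_le (c := c) (lam := lam) hS0 hκm hκp hφ.abs_sub_le
    have h3 : ‖(c : ℂ) + μ - ν + δ x - η (-x)‖ ≤ 6 * B / S := by
      rw [h1]
      have h4 := norm_sub_le ((evansKappa f c um lam - evansKappa f c up lam) / 2 + δ x) (η (-x))
      have h5 := norm_add_le ((evansKappa f c um lam - evansKappa f c up lam) / 2) (δ x)
      rw [norm_div, Complex.norm_two] at h5
      have h6 : 6 * B / S = 4 * B / S / 2 + 2 * B / S + 2 * B / S := by ring
      linarith [hδ2 x, hη2 (-x)]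
    rw [norm_mul]
    refine (mul_le_mul (hnear x hx).1 h3 (norm_nonneg _) (by norm_num)).trans (le_of_eq ?_)
    ring

theorem stepPotential_intervalIntegrable {φ : ℝ → ℝ} {lm lp : ℝ}
    (hφ : TwoSidedDecay φ lm lp B β) (hh : 0 < h) (N : ℕ) (a b : ℝ) :
    IntervalIntegrable (stepPotential φ h N) volume a b := by
  have hs := rightDecay_stepPotential hh hφ.rate_pos hφ.right N
  refine intervalIntegrable_of_bound (M := |lp| + B) hs.measurable (fun x => ?_) a b
  have h1 := hs.bound x
  have h2 := abs_add_le lp (stepPotential φ h N x - lp)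
  rw [add_sub_cancel] at h2
  linarith

/-- The quadrature error is bounded uniformly in the step size. -/
theorem abs_midpointQuadError_le {φ : ℝ → ℝ} {lm lp : ℝ}
    (hφ : TwoSidedDecay φ lm lp B β) (hh : 0 < h) (N : ℕ) :
    |midpointQuadError φ h N| ≤ 2 * B * expMass β := by
  have hB := hφ.pos
  rw [midpointQuadError_eq_integral (fun a b => hφ.continuous.intervalIntegrable a b)
    (stepPotential_intervalIntegrable hφ hh N) hh, ← Real.norm_eq_abs, ← Complex.norm_real,
    ← intervalIntegral.integral_ofReal]
  refine norm_intervalIntegral_le_expMass hφ.rate_pos (by positivity) fun x _ => ?_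
  rw [Complex.norm_real]
  exact abs_stepPotential_sub_le hh hφ.rate_pos hφ.right hφ.left N x

/-- The error of the numerical Evans function is the quadrature error up to `O(h ^ 2 / S)`. -/
theorem exists_norm_evansNumerical_sub_le {φ' φ'' : ℝ → ℝ} {C γ : ℝ}
    (hφ : TwoSidedDecay (wavePotential f uh) (deriv f um) (deriv f up) B β)
    (hγ : 0 < γ) (hd : ∀ x, HasDerivAt (wavePotential f uh) (φ' x) x)
    (hd' : ∀ x, HasDerivAt φ' (φ'' x) x)
    (hC : ∀ x, |φ' x| ≤ C * Real.exp (-γ * |x|)) (hC' : ∀ x, |φ'' x| ≤ C * Real.exp (-γ * |x|)) :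
    ∃ K, 0 ≤ K ∧ ∀ (S : ℝ) (lam : ℂ) (h : ℝ) (N : ℕ), 1 ≤ S → 8 * B ≤ S ^ 2 →
      4 * (2 * B * expMass β) ≤ S → 12 * B / β ≤ S →
      S ≤ (evansKappa f c um lam).re → S ≤ (evansKappa f c up lam).re → 0 < h →
      ‖evansNumerical f c um up uh lam h N - evansFunction f c um up uh lam
        - (midpointQuadError (wavePotential f uh) h N : ℂ)‖ ≤ K / S * h ^ 2 := by
  have hB := hφ.pos
  have hβ := hφ.rate_pos
  have hC0 : 0 ≤ C := by
    have := (abs_nonneg _).trans (hC 0)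
    simpa using this
  set T := 2 * B * expMass β with hT_def
  have hT : 0 ≤ T := mul_nonneg (by positivity) (expMass_nonneg β)
  -- `G / S` bounds both `p - 1` and `p'`, so it can serve as the single constant of the quadrature
  -- estimate.
  set G := 12 * B / β + 32 * B + 24 * T + 72 * B with hG_def
  have hG : 0 ≤ G := by positivity
  have hE := expMass_nonneg γ
  refine ⟨2 * (C * Real.exp γ) * G * expMass γ + G * T, by positivity, ?_⟩
  intro S lam h N hS hBS hTS hPS hκm hκp hh
  have hS0 : 0 < S := by linarith
  obtain ⟨p, p', hp, hrep, hp1, hp2⟩ := exists_evansProduct hφ hS hBS hTS hPS hκm hκp hh N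
  have hpc : Continuous p := continuous_iff_continuousAt.2 fun x => (hp x).continuousAt
  set φ := wavePotential f uh with hφ_def
  have hsi := stepPotential_intervalIntegrable hφ hh N
  have hqi : ∀ a b, IntervalIntegrable (fun x => ((stepPotential φ h N x - φ x : ℝ) : ℂ))
      volume a b := fun a b =>
    have := (hsi a b).sub (hφ.continuous.intervalIntegrable a b)
    ⟨this.1.ofReal, this.2.ofReal⟩
  have hdiff : evansNumerical f c um up uh lam h N - evansFunction f c um up uh lam
      - (midpointQuadError φ h N : ℂ)
      = ∫ x in -(N * h)..N * h, ((stepPotential φ h N x - φ x : ℝ) : ℂ) * (p x - 1) := by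
    rw [hrep, midpointQuadError_eq_integral (fun a b => hφ.continuous.intervalIntegrable a b) hsi hh,
      ← intervalIntegral.integral_ofReal,
      ← intervalIntegral.integral_sub ((hqi _ _).mul_continuousOn hpc.continuousOn) (hqi _ _)]
    simp only [mul_sub, mul_one]
  have hG1 : ∀ x ∈ Icc (-(N * h)) (N * h), ‖p x - 1‖ ≤ G / S := fun x hx =>
    (hp1 x hx).trans (div_le_div_of_nonneg_right (by rw [hG_def]; linarith) hS0.le)
  have hG2 : ∀ x ∈ Icc (-(N * h)) (N * h), ‖p' x‖ ≤ G / S := fun x hx =>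
    (hp2 x hx).trans (div_le_div_of_nonneg_right (by
      have : 0 ≤ 12 * B / β := by positivity
      rw [hG_def]; linarith) hS0.le)
  rw [hdiff]
  have hA : 0 ≤ 2 * (C * Real.exp γ) * G * expMass γ := by positivity
  rcases le_or_gt h 1 with hh1 | hh1
  · refine (norm_integral_stepPotential_sub_mul_le (g' := p') hγ hh hh1 hd hd' hC hC' hsi
      (by fun_prop) (fun x _ => (hp x).sub_const 1) hG1 hG2).trans ?_
    rw [show 2 * (C * Real.exp γ) * (G / S) * h ^ 2 * expMass γ
      = (2 * (C * Real.exp γ) * G * expMass γ) / S * h ^ 2 by ring]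
    refine mul_le_mul_of_nonneg_right (div_le_div_of_nonneg_right ?_ hS0.le) (sq_nonneg _)
    linarith [mul_nonneg hG hT]
  -- For `h > 1` no cancellation is needed: the integral is at most `G T / S`, and `1 ≤ h ^ 2`.
  · have hL : 0 ≤ N * h := by positivity
    refine (norm_intervalIntegral_le_expMass (M := 2 * B * (G / S)) hβ (by positivity)
      fun t ht => ?_).trans ?_
    · rw [uIcc_of_le (by linarith)] at ht
      rw [norm_mul, Complex.norm_real, mul_right_comm]
      exact mul_le_mul (abs_stepPotential_sub_le hh hβ hφ.right hφ.left N t) (hG1 t ht)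
        (norm_nonneg _) (by positivity)
    · rw [show 2 * B * (G / S) * expMass β = G * T / S * 1 by rw [hT_def]; ring]
      refine mul_le_mul (div_le_div_of_nonneg_right (by linarith) hS0.le) (by nlinarith)
        zero_le_one (by positivity)

end EvansProduct

/-! ### Jets, Taylor's formula and decay of derivatives -/

/-- `G k` is the `k`-th derivative of the smooth function `G 0`. -/
def IsJet (G : ℕ → ℝ → ℝ) : Prop := ∀ k x, HasDerivAt (G k) (G (k + 1) x) x

section Jet

variable {G : ℕ → ℝ → ℝ} {h : ℝ} {N : ℕ}

theorem IsJet.continuous (hG : IsJet G) (k : ℕ) : Continuous (G k) :=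
  continuous_iff_continuousAt.2 fun x => (hG k x).continuousAt

theorem IsJet.shift (hG : IsJet G) (j : ℕ) : IsJet fun k => G (k + j) := fun k x => by
  have := hG (k + j) x
  rwa [show k + j + 1 = k + 1 + j by ring] at this

/-- Taylor's formula with a crude remainder. -/
theorem IsJet.abs_sub_taylor_le (n : ℕ) {m : ℝ} : ∀ {G : ℕ → ℝ → ℝ} (_ : IsJet G) {M t : ℝ}
    (_ : ∀ y, |y| ≤ |t| → |G n (m + y)| ≤ M),
    |G 0 (m + t) - ∑ i ∈ Finset.range n, G i m * (t ^ i / (i.factorial : ℝ))| ≤ M * |t| ^ n := by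
  induction n with
  | zero => intro G hG M t hM; simpa using hM t le_rfl
  | succ n ih =>
    intro G hG M t hM
    have hM0 : 0 ≤ M := (abs_nonneg _).trans (hM t le_rfl)
    have hd : ∀ s ∈ Icc (-|t|) |t|, HasDerivWithinAt
        (fun s => G 0 (m + s) - ∑ i ∈ Finset.range (n + 1), G i m * (s ^ i / (i.factorial : ℝ)))
        (G 1 (m + s) - ∑ i ∈ Finset.range n, G (i + 1) m * (s ^ i / (i.factorial : ℝ)))
        (Icc (-|t|) |t|) s := by
      intro s _
      refine HasDerivAt.hasDerivWithinAt ?_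
      have h1 : HasDerivAt (fun s => G 0 (m + s)) (G 1 (m + s)) s := by
        simpa using (hG 0 (m + s)).comp_const_add m s
      refine h1.sub ?_
      simp only [Finset.sum_range_succ', pow_zero, Nat.factorial_zero, Nat.cast_one, div_one,
        mul_one]
      refine HasDerivAt.add_const _ (HasDerivAt.fun_sum fun i _ => ?_)
      refine (((hasDerivAt_pow (i + 1) s).div_const _).const_mul _).congr_deriv ?_
      rw [Nat.factorial_succ]
      have : (i.factorial : ℝ) ≠ 0 := by positivity
      push_cast
      field_simp
    -- The derivative of the Taylor remainder is the remainder of the shifted jet at one order less;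
    -- the mean value inequality then contributes the extra factor `|t|`.
    have hb : ∀ s ∈ Icc (-|t|) |t|,
        ‖G 1 (m + s) - ∑ i ∈ Finset.range n, G (i + 1) m * (s ^ i / (i.factorial : ℝ))‖
          ≤ M * |t| ^ n := by
      intro s hs
      have hs' : |s| ≤ |t| := abs_le.2 hs
      refine (ih (hG.shift 1) (M := M) (t := s) fun y hy => hM y (hy.trans hs')).trans ?_
      exact mul_le_mul_of_nonneg_left (pow_le_pow_left₀ (abs_nonneg _) hs' n) hM0
    have := (convex_Icc (-|t|) |t|).norm_image_sub_le_of_norm_hasDerivWithin_le hd hb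
      (x := 0) (y := t) ⟨by simp, by simp⟩ ⟨neg_abs_le t, le_abs_self t⟩
    have h0 : ∑ i ∈ Finset.range (n + 1), G i m * ((0 : ℝ) ^ i / (i.factorial : ℝ)) = G 0 m := by
      rw [Finset.sum_range_succ']
      simp
    simp only [add_zero, h0, sub_self, sub_zero] at this
    rw [pow_succ, ← mul_assoc]
    exact this

/-- Landau's inequality, for a function close to a constant. -/
theorem IsJet.abs_deriv_le (hG : IsJet G) {x t s B M : ℝ} (hs : 0 < s) (ht : |t| = s)
    (hM : ∀ y, |G 2 y| ≤ M) (hB : |G 0 (x + t) - G 0 x| ≤ B * s ^ 2) :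
    |G 1 x| ≤ (B + M) * s := by
  have h1 := IsJet.abs_sub_taylor_le 2 hG (m := x) (t := t) (M := M) fun y _ => hM _
  simp only [Finset.sum_range_succ, Finset.range_zero, Finset.sum_empty, ht] at h1
  norm_num at h1
  have h2 : |G 1 x * t| ≤ B * s ^ 2 + M * s ^ 2 := by
    have h3 := abs_sub (G 0 (x + t) - G 0 x) (G 0 (x + t) - (G 0 x + G 1 x * t))
    rw [show G 0 (x + t) - G 0 x - (G 0 (x + t) - (G 0 x + G 1 x * t)) = G 1 x * t by ring] at h3
    linarith
  rw [abs_mul, ht] at h2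
  have h3 : |G 1 x| * s ≤ (B + M) * s * s := by linarith
  exact le_of_mul_le_mul_right h3 hs

/-- Landau's inequality is used with increment `s = exp (-(β / 2) |x|)`, directed away from `0`:
then `s ^ 2` is the decay weight of `G 0`, and the derivative is of order `s`. -/
theorem IsJet.abs_deriv_le_exp (hG : IsJet G) {lm lp B β M : ℝ} (hβ : 0 < β)
    (hM : ∀ y, |G 2 y| ≤ M) (hr : ∀ x, 0 ≤ x → |G 0 x - lp| ≤ B * Real.exp (-β * x))
    (hl : ∀ x, x ≤ 0 → |G 0 x - lm| ≤ B * Real.exp (β * x)) (x : ℝ) :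
    |G 1 x| ≤ (2 * B + M) * Real.exp (-(β / 2) * |x|) := by
  have hB : 0 ≤ B := by
    have := (abs_nonneg _).trans (hr 0 le_rfl)
    simpa using this
  rcases le_total 0 x with hx | hx
  · rw [abs_of_nonneg hx]
    set s := Real.exp (-(β / 2) * x) with hs
    have hs0 : 0 < s := Real.exp_pos _
    have hss : s ^ 2 = Real.exp (-β * x) := by
      rw [hs, ← Real.exp_nat_mul]; congr 1; push_cast; ring
    refine hG.abs_deriv_le hs0 (abs_of_pos hs0) hM ?_
    have h1 := hr (x + s) (by linarith)
    have h2 := hr x hx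
    have h3 : Real.exp (-β * (x + s)) ≤ Real.exp (-β * x) := Real.exp_le_exp.2 (by nlinarith)
    have h4 := abs_sub_le (G 0 (x + s)) lp (G 0 x)
    rw [abs_sub_comm lp] at h4
    rw [hss]
    linarith [mul_le_mul_of_nonneg_left h3 hB]
  · rw [abs_of_nonpos hx]
    set s := Real.exp (-(β / 2) * -x) with hs
    have hs0 : 0 < s := Real.exp_pos _
    have hss : s ^ 2 = Real.exp (β * x) := by
      rw [hs, ← Real.exp_nat_mul]; congr 1; push_cast; ring
    refine hG.abs_deriv_le hs0 (t := -s) (by rw [abs_neg, abs_of_pos hs0]) hM ?_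
    have h1 := hl (x + -s) (by linarith)
    have h2 := hl x hx
    have h3 : Real.exp (β * (x + -s)) ≤ Real.exp (β * x) := Real.exp_le_exp.2 (by nlinarith)
    have h4 := abs_sub_le (G 0 (x + -s)) lm (G 0 x)
    rw [abs_sub_comm lm] at h4
    rw [hss]
    linarith [mul_le_mul_of_nonneg_left h3 hB]

/-- All derivatives of positive order decay exponentially. -/
def JetDecay (G : ℕ → ℝ → ℝ) : Prop :=
  ∀ k, ∃ C γ, 0 < γ ∧ ∀ x, |G (k + 1) x| ≤ C * Real.exp (-γ * |x|)

/-- The Landau estimate is iterated. After the first derivative both limits are `0`; each order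
halves the rate, so the rate depends on the order. -/
theorem IsJet.jetDecay (hG : IsJet G) {lm lp B β : ℝ} (hβ : 0 < β)
    (hM : ∀ k, ∃ M, ∀ y, |G k y| ≤ M)
    (hr : ∀ x, 0 ≤ x → |G 0 x - lp| ≤ B * Real.exp (-β * x))
    (hl : ∀ x, x ≤ 0 → |G 0 x - lm| ≤ B * Real.exp (β * x)) : JetDecay G := by
  intro k
  induction k with
  | zero =>
    obtain ⟨M, hM⟩ := hM 2
    exact ⟨_, _, half_pos hβ, hG.abs_deriv_le_exp hβ hM hr hl⟩
  | succ k ih =>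
    obtain ⟨C, γ, hγ, hC⟩ := ih
    obtain ⟨M, hM⟩ := hM (2 + (k + 1))
    have h1 := (hG.shift (k + 1)).abs_deriv_le_exp (lm := 0) (lp := 0) (B := C) hγ hM
      (fun x hx => by simpa [abs_of_nonneg hx] using hC x)
      (fun x hx => by simpa [abs_of_nonpos hx] using hC x)
    refine ⟨2 * C + M, _, half_pos hγ, fun x => ?_⟩
    have := h1 x
    rwa [show 1 + (k + 1) = k + 1 + 1 by ring] at this

theorem JetDecay.shift (hG : JetDecay G) (j : ℕ) : JetDecay fun k => G (k + j) := fun k => by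
  have := hG (k + j)
  rwa [show k + j + 1 = k + 1 + j by ring] at this

end Jet

/-! ### Euler–Maclaurin estimate of the midpoint quadrature error -/

section EulerMaclaurin

variable {G : ℕ → ℝ → ℝ} {h : ℝ} {N : ℕ}

/-- The midpoint sum on `[-N h, N h]`. -/
noncomputable def midpointSum (g : ℝ → ℝ) (h : ℝ) (N : ℕ) : ℝ :=
  h * ∑ k ∈ Finset.range (2 * N), g (node h N k + h / 2)

theorem midpointQuadError_eq_midpointSum_sub (g : ℝ → ℝ) (h : ℝ) (N : ℕ) :
    midpointQuadError g h N = midpointSum g h N - ∫ x in -(N * h)..N * h, g x := by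
  rw [midpointQuadError, sum_Ico_neg_eq_sum_range (fun j => g ((j : ℝ) * h + h / 2)), midpointSum]
  congr 2
  refine Finset.sum_congr rfl fun k _ => ?_
  congr 1
  simp only [node]
  push_cast
  ring

/-- The integral of `t ^ i / i!` over `[-1/2, 1/2]`. -/
noncomputable def monomialMoment (i : ℕ) : ℝ :=
  ((1 / 2) ^ (i + 1) - (-(1 / 2)) ^ (i + 1)) / ((i + 1 : ℕ) * (i.factorial : ℝ))

theorem monomialMoment_zero : monomialMoment 0 = 1 := by norm_num [monomialMoment]

theorem monomialMoment_one : monomialMoment 1 = 0 := by norm_num [monomialMoment]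

theorem abs_monomialMoment_le_one (i : ℕ) : |monomialMoment i| ≤ 1 := by
  have h1 : (1 : ℝ) ≤ (i + 1 : ℕ) * (i.factorial : ℝ) := by
    rw [← Nat.cast_mul]
    exact_mod_cast Nat.mul_pos (Nat.succ_pos i) i.factorial_pos
  have h2 : |((1 / 2 : ℝ)) ^ (i + 1) - (-(1 / 2)) ^ (i + 1)| ≤ 1 := by
    refine (abs_sub _ _).trans ?_
    rw [abs_pow, abs_pow, abs_neg, abs_of_pos (by norm_num : (0 : ℝ) < 1 / 2), pow_succ]
    have : (1 / 2 : ℝ) ^ i ≤ 1 := pow_le_one₀ (by norm_num) (by norm_num)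
    linarith
  rw [monomialMoment, abs_div, abs_of_pos (by linarith : (0 : ℝ) < (i + 1 : ℕ) * (i.factorial : ℝ))]
  exact div_le_one_of_le₀ (h2.trans h1) (by linarith)

theorem integral_monomial_cell (a h : ℝ) (i : ℕ) :
    ∫ x in a..a + h, (x - (a + h / 2)) ^ i / (i.factorial : ℝ)
      = monomialMoment i * h ^ i * h := by
  rw [intervalIntegral.integral_div,
    intervalIntegral.integral_comp_sub_right (fun x => x ^ i) (a + h / 2), integral_pow,
    monomialMoment]
  have h1 : a + h - (a + h / 2) = 1 / 2 * h := by ring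
  have h2 : a - (a + h / 2) = -(1 / 2) * h := by ring
  have : (i.factorial : ℝ) ≠ 0 := by positivity
  rw [h1, h2, mul_pow, mul_pow, pow_succ h]
  push_cast
  field_simp

/-- The Taylor expansion of the midpoint quadrature error. -/
theorem IsJet.abs_midpointQuadError_le (hG : IsJet G) (j : ℕ) {C γ : ℝ} (hγ : 0 < γ)
    (hC : ∀ x, |G (j + 2) x| ≤ C * Real.exp (-γ * |x|)) (hh : 0 < h) (hh1 : h ≤ 1) (N : ℕ) :
    |midpointQuadError (G 0) h N|
      ≤ (∑ i ∈ Finset.range j, h ^ (i + 2) * |midpointSum (G (i + 2)) h N|)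
        + C * Real.exp γ * expMass γ * h ^ (j + 2) := by
  have hC0 : 0 ≤ C := by
    have := (abs_nonneg _).trans (hC 0)
    simpa using this
  have hL : 0 ≤ N * h := by positivity
  set R : ℝ → ℝ → ℝ := fun m x =>
    G 0 x - ∑ i ∈ Finset.range (j + 2), G i m * ((x - m) ^ i / (i.factorial : ℝ)) with hR_def
  have hRc : ∀ m, Continuous (R m) := fun m => by
    have := hG.continuous 0
    simp only [hR_def]
    fun_prop
  have hRb : ∀ k, |∫ x in node h N k..node h N k + h, R (node h N k + h / 2) x|
      ≤ C * Real.exp γ * h ^ (j + 2)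
        * ∫ x in node h N k..node h N k + h, Real.exp (-γ * |x|) := by
    intro k
    rw [← intervalIntegral.integral_const_mul, ← Real.norm_eq_abs]
    refine intervalIntegral.norm_integral_le_of_norm_le (by linarith)
      (Eventually.of_forall fun x hx => ?_) (Continuous.intervalIntegrable (by fun_prop) _ _)
    have hxm : |x - (node h N k + h / 2)| ≤ h / 2 := by
      rw [abs_le]; constructor <;> linarith [hx.1, hx.2]
    have h1 := IsJet.abs_sub_taylor_le (j + 2) hG (m := node h N k + h / 2)
      (t := x - (node h N k + h / 2)) (M := C * (Real.exp γ * Real.exp (-γ * |x|))) fun y hy => by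
        refine (hC _).trans (mul_le_mul_of_nonneg_left (exp_neg_mul_abs_le hγ ?_) hC0)
        have h2 : node h N k + h / 2 + y - x = y - (x - (node h N k + h / 2)) := by ring
        rw [h2]
        have := abs_sub y (x - (node h N k + h / 2))
        linarith
    rw [add_sub_cancel] at h1
    refine h1.trans ?_
    have h3 : |x - (node h N k + h / 2)| ^ (j + 2) ≤ h ^ (j + 2) :=
      pow_le_pow_left₀ (abs_nonneg _) (by linarith) _
    refine (mul_le_mul_of_nonneg_left h3 (by positivity)).trans (le_of_eq (by ring))
  have hRe : ∀ k, ∫ x in node h N k..node h N k + h, R (node h N k + h / 2) x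
      = (∫ x in node h N k..node h N k + h, G 0 x)
        - ∑ i ∈ Finset.range (j + 2),
          monomialMoment i * h ^ i * (h * G i (node h N k + h / 2)) := by
    intro k
    simp only [hR_def]
    rw [intervalIntegral.integral_sub ((hG.continuous 0).intervalIntegrable _ _)
      (Continuous.intervalIntegrable (by fun_prop) _ _), intervalIntegral.integral_finsetSum
      fun i _ => Continuous.intervalIntegrable (by fun_prop) _ _]
    congr 1
    refine Finset.sum_congr rfl fun i _ => ?_
    rw [intervalIntegral.integral_const_mul, integral_monomial_cell]
    ring
  have hsum : ∑ k ∈ Finset.range (2 * N),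
      ∫ x in node h N k..node h N k + h, R (node h N k + h / 2) x
      = (∫ x in -(N * h)..N * h, G 0 x)
        - ∑ i ∈ Finset.range (j + 2), monomialMoment i * h ^ i * midpointSum (G i) h N := by
    rw [Finset.sum_congr rfl fun k _ => hRe k, Finset.sum_sub_distrib, Finset.sum_comm,
      ← sum_integral_cells fun a b => (hG.continuous 0).intervalIntegrable a b]
    simp only [node_succ, midpointSum, Finset.mul_sum]
  -- The zeroth moment reproduces the midpoint sum of `G 0` and the first moment vanishes, so the
  -- expansion starts with `h ^ 2` and second derivatives.
  have hQ : midpointQuadError (G 0) h N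
      = -(∑ k ∈ Finset.range (2 * N),
          ∫ x in node h N k..node h N k + h, R (node h N k + h / 2) x)
        - ∑ i ∈ Finset.range j,
          monomialMoment (i + 2) * h ^ (i + 2) * midpointSum (G (i + 2)) h N := by
    rw [midpointQuadError_eq_midpointSum_sub, hsum, Finset.sum_range_succ', Finset.sum_range_succ',
      monomialMoment_zero, monomialMoment_one]
    ring
  have hA : |∑ k ∈ Finset.range (2 * N),
      ∫ x in node h N k..node h N k + h, R (node h N k + h / 2) x|
      ≤ C * Real.exp γ * expMass γ * h ^ (j + 2) := by
    refine (Finset.abs_sum_le_sum_abs _ _).trans ((Finset.sum_le_sum fun k _ => hRb k).trans ?_)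
    have h1 := sum_integral_cells (F := fun x => Real.exp (-γ * |x|))
      (fun a b => Continuous.intervalIntegrable (by fun_prop) a b) h N
    simp only [node_succ] at h1
    rw [← Finset.mul_sum, h1, mul_right_comm]
    refine mul_le_mul_of_nonneg_left ?_ (by positivity) |>.trans
      (le_of_eq (mul_right_comm _ _ _)) |>.trans' (le_of_eq (mul_right_comm _ _ _))
    rw [intervalIntegral.integral_of_le (by linarith)]
    exact setIntegral_le_integral (integrable_exp_neg_mul_abs hγ)
      (Eventually.of_forall fun x => (Real.exp_pos _).le)
  have hBd : |∑ i ∈ Finset.range j,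
      monomialMoment (i + 2) * h ^ (i + 2) * midpointSum (G (i + 2)) h N|
      ≤ ∑ i ∈ Finset.range j, h ^ (i + 2) * |midpointSum (G (i + 2)) h N| := by
    refine (Finset.abs_sum_le_sum_abs _ _).trans (Finset.sum_le_sum fun i _ => ?_)
    rw [abs_mul, abs_mul, abs_of_pos (pow_pos hh _), mul_assoc]
    exact mul_le_of_le_one_left (by positivity) (abs_monomialMoment_le_one _)
  rw [hQ]
  refine (abs_sub _ _).trans ?_
  rw [abs_neg]
  linarith

/-- Quantities bounded by a constant times `h ^ 2 exp (-β N h) + h ^ (2 m + 2)` for `h ≤ 1`. -/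
def QuadSmall (m : ℕ) (F : ℝ → ℕ → ℝ) : Prop :=
  ∃ C β : ℝ, 0 ≤ C ∧ 0 < β ∧ ∀ (h : ℝ) (N : ℕ), 0 < h → h ≤ 1 →
    F h N ≤ C * (h ^ 2 * Real.exp (-(β * (N * h))) + h ^ (2 * m + 2))

theorem QuadSmall.add {m : ℕ} {F F' : ℝ → ℕ → ℝ} (hF : QuadSmall m F) (hF' : QuadSmall m F') :
    QuadSmall m fun h N => F h N + F' h N := by
  obtain ⟨C, β, hC, hβ, h1⟩ := hF
  obtain ⟨C', β', hC', hβ', h2⟩ := hF'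
  refine ⟨C + C', min β β', by positivity, lt_min hβ hβ', fun h N hh hh1 => ?_⟩
  have hL : 0 ≤ N * h := by positivity
  have e1 : Real.exp (-(β * (N * h))) ≤ Real.exp (-(min β β' * (N * h))) :=
    Real.exp_le_exp.2 (neg_le_neg (mul_le_mul_of_nonneg_right (min_le_left _ _) hL))
  have e2 : Real.exp (-(β' * (N * h))) ≤ Real.exp (-(min β β' * (N * h))) :=
    Real.exp_le_exp.2 (neg_le_neg (mul_le_mul_of_nonneg_right (min_le_right _ _) hL))
  rw [add_mul]
  refine add_le_add ((h1 h N hh hh1).trans ?_) ((h2 h N hh hh1).trans ?_) <;> gcongr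

theorem QuadSmall.sum {m : ℕ} {F : ℕ → ℝ → ℕ → ℝ} (hF : ∀ i, QuadSmall m (F i)) (j : ℕ) :
    QuadSmall m fun h N => ∑ i ∈ Finset.range j, F i h N := by
  induction j with
  | zero => exact ⟨0, 1, le_rfl, one_pos, fun h N _ _ => by simp⟩
  | succ j ih =>
    simp only [Finset.sum_range_succ]
    exact ih.add (hF j)

theorem QuadSmall.mono {m : ℕ} {F F' : ℝ → ℕ → ℝ} (hF : QuadSmall m F)
    (hle : ∀ h N, 0 < h → h ≤ 1 → F' h N ≤ F h N) : QuadSmall m F' := by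
  obtain ⟨C, β, hC, hβ, h1⟩ := hF
  exact ⟨C, β, hC, hβ, fun h N hh hh1 => (hle h N hh hh1).trans (h1 h N hh hh1)⟩

theorem QuadSmall.of_pow (m : ℕ) {C : ℝ} (hC : 0 ≤ C) :
    QuadSmall m fun h _ => C * h ^ (2 * m + 2) :=
  ⟨C, 1, hC, one_pos, fun h N hh _ => mul_le_mul_of_nonneg_left
    (le_add_of_nonneg_left (by positivity)) hC⟩

/-- The midpoint rule is spectrally accurate up to boundary terms. -/
theorem IsJet.quadSmall_midpointQuadError (m : ℕ) : ∀ {G : ℕ → ℝ → ℝ}, IsJet G → JetDecay G →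
    QuadSmall m fun h N => |midpointQuadError (G 0) h N| := by
  induction m with
  | zero =>
    intro G hG hD
    obtain ⟨C, γ, hγ, hC⟩ := hD 1
    have hC0 : 0 ≤ C := by
      have := (abs_nonneg _).trans (hC 0)
      simpa using this
    refine (QuadSmall.of_pow 0 (C := C * Real.exp γ * expMass γ) (mul_nonneg (by positivity)
      (expMass_nonneg γ))).mono fun h N hh hh1 => ?_
    simpa using hG.abs_midpointQuadError_le 0 hγ hC hh hh1 N
  | succ m ih =>
    intro G hG hD
    -- The remainder must have order `2 (m + 1) + 2 = 2 m + 4`; `JetDecay` at index `2 m + 3`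
    -- controls the derivative of that order.
    obtain ⟨C, γ, hγ, hC⟩ := hD (2 * m + 3)
    have hC0 : 0 ≤ C := by
      have := (abs_nonneg _).trans (hC 0)
      simpa using this
    have hterm : ∀ i, QuadSmall (m + 1) fun h N => h ^ (i + 2) * |midpointSum (G (i + 2)) h N| := by
      intro i
      obtain ⟨C₁, β₁, hC₁, hβ₁, hQ⟩ := ih (hG.shift (i + 2)) (hD.shift (i + 2))
      obtain ⟨C₂, γ₂, hγ₂, hC₂⟩ := hD i
      have hC₂0 : 0 ≤ C₂ := by
        have := (abs_nonneg _).trans (hC₂ 0)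
        simpa using this
      -- The midpoint sum of a higher derivative is its quadrature error plus its integral. The
      -- prefactor, at most `h ^ 2`, raises the induction hypothesis for the quadrature error by two
      -- powers of `h`.
      have hA : QuadSmall (m + 1) fun h N => h ^ 2 * |midpointQuadError (G (i + 2)) h N| := by
        refine ⟨C₁, β₁, hC₁, hβ₁, fun h N hh hh1 => ?_⟩
        have h1 := hQ h N hh hh1
        simp only [zero_add] at h1
        refine (mul_le_mul_of_nonneg_left h1 (sq_nonneg h)).trans ?_
        have h2 : h ^ 2 ≤ 1 := pow_le_one₀ hh.le hh1
        have h3 : h ^ 2 * (h ^ 2 * Real.exp (-(β₁ * (N * h))))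
            ≤ h ^ 2 * Real.exp (-(β₁ * (N * h))) := mul_le_of_le_one_left (by positivity) h2
        have h4 : h ^ (2 * (m + 1) + 2) = h ^ 2 * h ^ (2 * m + 2) := by ring
        rw [h4]
        have := mul_le_mul_of_nonneg_left h3 hC₁
        linarith
      have hB : QuadSmall (m + 1) fun h N => h ^ 2 * |∫ x in -(N * h)..N * h, G (i + 2) x| := by
        refine ⟨2 * C₂, γ₂, by positivity, hγ₂, fun h N hh hh1 => ?_⟩
        have hL : 0 ≤ N * h := by positivity
        -- The integral of a derivative consists of boundary values of the preceding derivative,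
        -- which are exponentially small in `L`.
        have hI : ∫ x in -(N * h)..N * h, G (i + 2) x = G (i + 1) (N * h) - G (i + 1) (-(N * h)) :=
          intervalIntegral.integral_eq_sub_of_hasDerivAt (fun x _ => hG (i + 1) x)
            ((hG.continuous (i + 2)).intervalIntegrable _ _)
        simp only [hI]
        have h1 := hC₂ (N * h)
        have h2 := hC₂ (-(N * h))
        rw [abs_neg] at h2
        rw [abs_of_nonneg hL, neg_mul] at h1 h2
        have h3 := abs_sub (G (i + 1) (N * h)) (G (i + 1) (-(N * h)))
        have h4 : 0 ≤ h ^ (2 * (m + 1) + 2) := by positivity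
        have h5 : |G (i + 1) (N * h) - G (i + 1) (-(N * h))|
            ≤ 2 * C₂ * Real.exp (-(γ₂ * (N * h))) := by linarith
        have h6 := mul_le_mul_of_nonneg_left h5 (sq_nonneg h)
        have h7 := mul_nonneg (mul_nonneg zero_le_two hC₂0) h4
        linarith
      refine (hA.add hB).mono fun h N hh hh1 => ?_
      have h1 : h ^ (i + 2) ≤ h ^ 2 := pow_le_pow_of_le_one hh.le hh1 (by omega)
      have h2 : midpointSum (G (i + 2)) h N = midpointQuadError (G (i + 2)) h N
          + ∫ x in -(N * h)..N * h, G (i + 2) x := by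
        rw [midpointQuadError_eq_midpointSum_sub]; ring
      rw [← mul_add, h2]
      exact mul_le_mul h1 (abs_add_le _ _) (abs_nonneg _) (sq_nonneg h)
    refine ((QuadSmall.sum hterm (2 * m + 2)).add (QuadSmall.of_pow (m + 1)
      (C := C * Real.exp γ * expMass γ) (mul_nonneg (by positivity) (expMass_nonneg γ)))).mono
      fun h N hh hh1 => ?_
    exact hG.abs_midpointQuadError_le (2 * m + 2) hγ hC hh hh1 N

end EulerMaclaurin

/-! ### Functions with bounded derivatives -/

section BoundedDerivatives

/-- `g` is `n` times continuously differentiable with bounded derivatives of order at most `n`. -/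
def BddDeriv : ℕ → (ℝ → ℝ) → Prop
  | 0, g => Continuous g ∧ ∃ M, ∀ x, |g x| ≤ M
  | n + 1, g => (∃ M, ∀ x, |g x| ≤ M) ∧ Differentiable ℝ g ∧ BddDeriv n (deriv g)

namespace BddDeriv

variable {g k : ℝ → ℝ} {n : ℕ}

theorem bound (h : BddDeriv n g) : ∃ M, ∀ x, |g x| ≤ M := by
  cases n with
  | zero => exact h.2
  | succ n => exact h.1

theorem of_succ : ∀ {n : ℕ} {g : ℝ → ℝ}, BddDeriv (n + 1) g → BddDeriv n g
  | 0, _, h => ⟨h.2.1.continuous, h.1⟩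
  | _ + 1, _, h => ⟨h.1, h.2.1, of_succ h.2.2⟩

theorem bound_add (hg : ∃ M, ∀ x, |g x| ≤ M) (hk : ∃ M, ∀ x, |k x| ≤ M) :
    ∃ M, ∀ x, |g x + k x| ≤ M := by
  obtain ⟨M, hM⟩ := hg
  obtain ⟨M', hM'⟩ := hk
  exact ⟨M + M', fun x => (abs_add_le _ _).trans (add_le_add (hM x) (hM' x))⟩

theorem bound_mul (hg : ∃ M, ∀ x, |g x| ≤ M) (hk : ∃ M, ∀ x, |k x| ≤ M) :
    ∃ M, ∀ x, |g x * k x| ≤ M := by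
  obtain ⟨M, hM⟩ := hg
  obtain ⟨M', hM'⟩ := hk
  refine ⟨M * M', fun x => ?_⟩
  rw [abs_mul]
  exact mul_le_mul (hM x) (hM' x) (abs_nonneg _) ((abs_nonneg _).trans (hM x))

theorem add : ∀ {n : ℕ} {g k : ℝ → ℝ}, BddDeriv n g → BddDeriv n k →
    BddDeriv n fun x => g x + k x
  | 0, _, _, hg, hk => ⟨hg.1.add hk.1, bound_add hg.2 hk.2⟩
  | n + 1, g, k, hg, hk => by
    refine ⟨bound_add hg.1 hk.1, hg.2.1.add hk.2.1, ?_⟩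
    have : deriv (fun x => g x + k x) = fun x => deriv g x + deriv k x :=
      funext fun x => deriv_fun_add (hg.2.1 x) (hk.2.1 x)
    rw [this]
    exact hg.2.2.add hk.2.2

theorem mul : ∀ {n : ℕ} {g k : ℝ → ℝ}, BddDeriv n g → BddDeriv n k →
    BddDeriv n fun x => g x * k x
  | 0, _, _, hg, hk => ⟨hg.1.mul hk.1, bound_mul hg.2 hk.2⟩
  | n + 1, g, k, hg, hk => by
    refine ⟨bound_mul hg.1 hk.1, hg.2.1.mul hk.2.1, ?_⟩
    have : deriv (fun x => g x * k x) = fun x => deriv g x * k x + g x * deriv k x :=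
      funext fun x => deriv_fun_mul (hg.2.1 x) (hk.2.1 x)
    rw [this]
    exact (hg.2.2.mul hk.of_succ).add (hg.of_succ.mul hk.2.2)

theorem const (c : ℝ) : ∀ n : ℕ, BddDeriv n fun _ => c
  | 0 => ⟨continuous_const, |c|, fun _ => le_rfl⟩
  | n + 1 => ⟨⟨|c|, fun _ => le_rfl⟩, differentiable_const c, by
      rw [deriv_const']; exact const 0 n⟩

theorem bound_comp {f : ℝ → ℝ} (hf : Continuous f) (hg : ∃ M, ∀ x, |g x| ≤ M) :
    ∃ M, ∀ x, |f (g x)| ≤ M := by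
  obtain ⟨M, hM⟩ := hg
  obtain ⟨M', hM'⟩ := (isCompact_Icc (a := -M) (b := M)).exists_bound_of_continuousOn
    hf.continuousOn
  exact ⟨M', fun x => hM' _ (abs_le.1 (hM x))⟩

theorem comp : ∀ {n : ℕ} {g f : ℝ → ℝ}, ContDiff ℝ ∞ f → BddDeriv n g →
    BddDeriv n fun x => f (g x)
  | 0, _, _, hf, hg => ⟨hf.continuous.comp hg.1, bound_comp hf.continuous hg.2⟩
  | n + 1, g, f, hf, hg => by
    have hfd : Differentiable ℝ f := hf.differentiable (by simp)
    refine ⟨bound_comp hf.continuous hg.1, hfd.comp hg.2.1, ?_⟩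
    have h1 : deriv (fun x => f (g x)) = fun x => deriv f (g x) * deriv g x :=
      funext fun x => deriv_comp x (hfd _) (hg.2.1 x)
    rw [h1]
    exact (comp (contDiff_infty_iff_deriv.1 hf).2 hg.of_succ).mul hg.2.2

theorem iteratedDeriv : ∀ (k : ℕ) {n : ℕ} {g : ℝ → ℝ}, BddDeriv (n + k) g →
    BddDeriv n (iteratedDeriv k g)
  | 0, _, _, h => by simpa using h
  | k + 1, n, g, h => by
    rw [iteratedDeriv_succ']
    exact iteratedDeriv k h.2.2

theorem isJet (h : ∀ n, BddDeriv n g) : IsJet fun k => _root_.iteratedDeriv k g := fun k x => by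
  have h1 : BddDeriv 1 (_root_.iteratedDeriv k g) := iteratedDeriv k (h _)
  simp only [iteratedDeriv_succ]
  exact (h1.2.1 x).hasDerivAt

end BddDeriv

end BoundedDerivatives

/-! ### Smoothness and decay of the wave potential -/

section Wave

variable {f uh : ℝ → ℝ} {c um up : ℝ}

theorem exists_bound_of_tendsto {g : ℝ → ℝ} {a b : ℝ} (hg : Continuous g)
    (ha : Tendsto g atBot (𝓝 a)) (hb : Tendsto g atTop (𝓝 b)) : ∃ M, ∀ x, |g x| ≤ M := by
  have h1 : ∀ᶠ x in atBot, |g x| < |a| + 1 := ha.abs.eventually_lt_const (by linarith)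
  have h2 : ∀ᶠ x in atTop, |g x| < |b| + 1 := hb.abs.eventually_lt_const (by linarith)
  obtain ⟨A, hA⟩ := eventually_atBot.1 h1
  obtain ⟨B, hB⟩ := eventually_atTop.1 h2
  obtain ⟨M, hM⟩ := (isCompact_Icc (a := A) (b := B)).exists_bound_of_continuousOn hg.continuousOn
  refine ⟨max M (max (|a| + 1) (|b| + 1)), fun x => ?_⟩
  rcases le_total x A with hx | hx
  · exact (hA x hx).le.trans ((le_max_left _ _).trans (le_max_right _ _))
  rcases le_total B x with hx' | hx'
  · exact (hB x hx').le.trans ((le_max_right _ _).trans (le_max_right _ _))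
  · exact (hM x ⟨hx, hx'⟩).trans (le_max_left _ _)

/-- The derivative of a bounded solution of `u'' + c u' = g` with bounded `g` is bounded. -/
theorem exists_bound_deriv_of_ode {u u' g : ℝ → ℝ} {M F : ℝ} (hu : ∀ x, HasDerivAt u (u' x) x)
    (hu' : ∀ x, HasDerivAt u' (g x - c * u' x) x) (hM : ∀ x, |u x| ≤ M) (hF : ∀ x, |g x| ≤ F) :
    ∃ M', ∀ x, |u' x| ≤ M' := by
  refine ⟨Real.exp |c| * (2 * M + F), fun x => ?_⟩
  -- The mean value theorem finds, within distance `1` of `x`, a point where `|u'| ≤ 2 M`. The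
  -- integrating factor `exp (c (t - x))`, equal to `1` at `t = x`, carries this bound back to `x`.
  obtain ⟨ξ, hξ, hξ'⟩ := exists_hasDerivAt_eq_slope u u' (by linarith : x < x + 1)
    (continuous_iff_continuousAt.2 fun y => (hu y).continuousAt).continuousOn
    (fun y _ => hu y)
  have hF0 : 0 ≤ F := (abs_nonneg _).trans (hF 0)
  have h1 : |u' ξ| ≤ 2 * M := by
    rw [hξ', add_sub_cancel_left, div_one]
    refine (abs_sub _ _).trans ?_
    linarith [hM x, hM (x + 1)]
  have hexp : ∀ t ∈ Icc x (x + 1), Real.exp (c * (t - x)) ≤ Real.exp |c| := fun t ht => by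
    refine Real.exp_le_exp.2 ((le_abs_self _).trans ?_)
    rw [abs_mul]
    refine mul_le_of_le_one_right (abs_nonneg _) ?_
    rw [abs_le]; constructor <;> linarith [ht.1, ht.2]
  have hd : ∀ t ∈ Icc x (x + 1), HasDerivWithinAt (fun t => Real.exp (c * (t - x)) * u' t)
      (Real.exp (c * (t - x)) * g t) (Icc x (x + 1)) t := fun t _ => by
    have h2 : HasDerivAt (fun t => Real.exp (c * (t - x))) (Real.exp (c * (t - x)) * c) t := by
      simpa using (((hasDerivAt_id t).sub_const x).const_mul c).exp
    exact ((h2.mul (hu' t)).congr_deriv (by ring)).hasDerivWithinAt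
  have hb : ∀ t ∈ Icc x (x + 1), ‖Real.exp (c * (t - x)) * g t‖ ≤ Real.exp |c| * F :=
    fun t ht => by
    rw [norm_mul, Real.norm_eq_abs, Real.norm_eq_abs, Real.abs_exp]
    exact mul_le_mul (hexp t ht) (hF t) (abs_nonneg _) (Real.exp_pos _).le
  have hξI : ξ ∈ Icc x (x + 1) := Ioo_subset_Icc_self hξ
  have h3 := (convex_Icc x (x + 1)).norm_image_sub_le_of_norm_hasDerivWithin_le hd hb hξI
    (left_mem_Icc.2 (by linarith))
  simp only [sub_self, mul_zero, Real.exp_zero, one_mul, Real.norm_eq_abs] at h3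
  have h4 : |x - ξ| ≤ 1 := by rw [abs_le]; constructor <;> linarith [hξI.1, hξI.2]
  have h5 : |Real.exp (c * (ξ - x)) * u' ξ| ≤ Real.exp |c| * (2 * M) := by
    rw [abs_mul, Real.abs_exp]
    exact mul_le_mul (hexp ξ hξI) h1 (abs_nonneg _) (Real.exp_pos _).le
  have h6 := abs_add_le (u' x - Real.exp (c * (ξ - x)) * u' ξ) (Real.exp (c * (ξ - x)) * u' ξ)
  rw [sub_add_cancel] at h6
  have h7 : Real.exp |c| * F * |x - ξ| ≤ Real.exp |c| * F * 1 :=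
    mul_le_mul_of_nonneg_left h4 (by positivity)
  linarith

/-- Bootstrapping: `u'' = -c u' - f(u)` expresses the second derivative by lower ones, so each use
of the equation gains an order of bounded differentiability. It starts from the boundedness of `u`,
given by its limits, and of `u'`. -/
theorem IsTravellingWave.bddDeriv (hf : ContDiff ℝ ∞ f) (hw : IsTravellingWave f c um up uh)
    (n : ℕ) : BddDeriv n uh := by
  have hd : Differentiable ℝ uh := hw.contDiff.differentiable (by norm_num)
  have hd' : ContDiff ℝ 1 (deriv uh) := by
    have := (contDiff_succ_iff_deriv (n := 1) (f := uh)).1 (by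
      rw [one_add_one_eq_two]; exact hw.contDiff)
    exact this.2.2
  have hdd : Differentiable ℝ (deriv uh) := hd'.differentiable (by norm_num)
  have hb := exists_bound_of_tendsto hd.continuous hw.tendsto_left hw.tendsto_right
  have hdder : deriv (deriv uh) = fun x => -c * deriv uh x + -1 * f (uh x) :=
    funext fun x => by linarith [hw.ode x]
  have hb' : ∃ M, ∀ x, |deriv uh x| ≤ M := by
    obtain ⟨F, hF⟩ := BddDeriv.bound_comp hf.continuous hb
    obtain ⟨M, hM⟩ := hb
    refine exists_bound_deriv_of_ode (c := c) (g := fun x => -f (uh x)) (F := F)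
      (fun x => (hd x).hasDerivAt) (fun x => ?_) hM (fun x => by rw [abs_neg]; exact hF x)
    refine (hdd x).hasDerivAt.congr_deriv ?_
    rw [hdder]; ring
  have key : ∀ n, BddDeriv (n + 1) uh := by
    intro n
    induction n with
    | zero => exact ⟨hb, hd, hdd.continuous, hb'⟩
    | succ n ih =>
      refine ⟨hb, hd, hb', hdd, ?_⟩
      rw [hdder]
      exact ((BddDeriv.const (-c) n).mul ih.2.2).add
        ((BddDeriv.const (-1) n).mul (BddDeriv.comp hf ih.of_succ))
  exact (key n).of_succ

theorem IsTravellingWave.bddDeriv_wavePotential (hf : ContDiff ℝ ∞ f)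
    (hw : IsTravellingWave f c um up uh) (n : ℕ) : BddDeriv n (wavePotential f uh) :=
  BddDeriv.comp (f := deriv f) (contDiff_infty_iff_deriv.1 hf).2 (hw.bddDeriv hf n)

/-- An eventual exponential bound for a bounded function is a bound on the half line. -/
theorem exists_exp_bound_of_isBigO {g : ℝ → ℝ} {α M : ℝ} (hα : 0 < α) (hM : ∀ x, |g x| ≤ M)
    (hg : g =O[atTop] fun ξ => Real.exp (-(α * ξ))) :
    ∃ B, ∀ x, 0 ≤ x → |g x| ≤ B * Real.exp (-α * x) := by
  obtain ⟨C, hC⟩ := hg.bound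
  obtain ⟨A, hA⟩ := eventually_atTop.1 hC
  have hM0 : 0 ≤ M := (abs_nonneg _).trans (hM 0)
  -- On `[0, A]`, where the asymptotic bound is not available, `exp (α |A|)` compensates the
  -- smallest value of the weight.
  refine ⟨max C (M * Real.exp (α * |A|)), fun x hx => ?_⟩
  rcases le_total A x with h | h
  · have h1 := hA x h
    rw [Real.norm_eq_abs, Real.norm_eq_abs, Real.abs_exp, ← neg_mul] at h1
    exact h1.trans (mul_le_mul_of_nonneg_right (le_max_left _ _) (Real.exp_pos _).le)
  · refine le_trans ?_ (mul_le_mul_of_nonneg_right (le_max_right _ _) (Real.exp_pos _).le)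
    rw [mul_assoc, ← Real.exp_add]
    refine (hM x).trans (le_mul_of_one_le_right hM0 (Real.one_le_exp ?_))
    nlinarith [le_abs_self A]

/-- The rate parameter is `α / 2` because `TwoSidedDecay` measures decay at twice its parameter, the
half being reserved for the step potential. The `1` in the maximum makes `B` positive. -/
theorem exists_twoSidedDecay {α : ℝ} (hα : 0 < α) (hφc : Continuous (wavePotential f uh))
    (hb : ∃ M, ∀ x, |wavePotential f uh x| ≤ M)
    (hleft : (fun ξ => wavePotential f uh ξ - deriv f um) =O[atBot] fun ξ => Real.exp (α * ξ))
    (hright : (fun ξ => wavePotential f uh ξ - deriv f up) =O[atTop]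
      fun ξ => Real.exp (-(α * ξ))) :
    ∃ B, TwoSidedDecay (wavePotential f uh) (deriv f um) (deriv f up) B (α / 2) := by
  obtain ⟨M, hM⟩ := hb
  have hM' : ∀ l x, |wavePotential f uh x - l| ≤ M + |l| := fun l x =>
    (abs_sub _ _).trans (by linarith [hM x])
  obtain ⟨B₁, hB₁⟩ := exists_exp_bound_of_isBigO hα (hM' _) hright
  have hleft' : (fun ξ => wavePotential f uh (-ξ) - deriv f um) =O[atTop]
      fun ξ => Real.exp (-(α * ξ)) := by
    have := hleft.comp_tendsto tendsto_neg_atTop_atBot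
    refine this.congr (fun x => rfl) fun x => ?_
    simp
  obtain ⟨B₂, hB₂⟩ := exists_exp_bound_of_isBigO hα (fun x => hM' (deriv f um) (-x)) hleft'
  set B := max 1 (max (max B₁ B₂) (max (M + |deriv f um|) (M + |deriv f up|))) with hB
  have h1 : B₁ ≤ B := (le_max_left _ _).trans ((le_max_left _ _).trans (le_max_right _ _))
  have h2 : B₂ ≤ B := (le_max_right _ _).trans ((le_max_left _ _).trans (le_max_right _ _))
  have h3 : M + |deriv f um| ≤ B :=
    (le_max_left _ _).trans ((le_max_right _ _).trans (le_max_right _ _))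
  have h4 : M + |deriv f up| ≤ B :=
    (le_max_right _ _).trans ((le_max_right _ _).trans (le_max_right _ _))
  have h2α : 2 * (α / 2) = α := by ring
  refine ⟨B, hφc, zero_lt_one.trans_le (le_max_left _ _), half_pos hα,
    ⟨hφc.measurable, fun x => (hM' _ x).trans h4, fun x hx => ?_⟩,
    ⟨(hφc.comp continuous_neg).measurable, fun x => (hM' _ _).trans h3, fun x hx => ?_⟩⟩
  · rw [h2α]
    exact (hB₁ x hx).trans (mul_le_mul_of_nonneg_right h1 (Real.exp_pos _).le)
  · rw [h2α]
    exact (hB₂ x hx).trans (mul_le_mul_of_nonneg_right h2 (Real.exp_pos _).le)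

end Wave

/-! ### Lower bounds for the real parts of the roots in the sector -/

section Sector

variable {f : ℝ → ℝ} {c um up ε : ℝ}

/-- `κ ^ 2` differs from `4 lam` by a fixed constant, which for large `lam` consumes at most `3
|lam|`. -/
theorem norm_le_norm_evansKappa_sq {u : ℝ} {lam : ℂ}
    (h : c ^ 2 + 4 * |deriv f u| ≤ 3 * ‖lam‖) : ‖lam‖ ≤ ‖evansKappa f c u lam‖ ^ 2 := by
  rw [← norm_pow, evansKappa_sq]
  have h1 : 4 * lam = ((c : ℂ) ^ 2 + 4 * (lam - ((deriv f u : ℝ) : ℂ)))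
      - ((c ^ 2 - 4 * deriv f u : ℝ) : ℂ) := by push_cast; ring
  have h2 := norm_sub_le ((c : ℂ) ^ 2 + 4 * (lam - ((deriv f u : ℝ) : ℂ)))
    ((c ^ 2 - 4 * deriv f u : ℝ) : ℂ)
  rw [← h1, norm_mul, Complex.norm_real, Real.norm_eq_abs] at h2
  have h3 := abs_sub (c ^ 2) (4 * deriv f u)
  rw [abs_of_nonneg (sq_nonneg c), abs_mul, abs_of_pos (by norm_num : (0 : ℝ) < 4)] at h3
  have h4 : ‖(4 : ℂ)‖ = 4 := by simp
  rw [h4] at h2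
  linarith

/-- In the sector, the real parts of `κ₋` and `κ₊` are comparable to `|lam| ^ (1 / 2)`. -/
theorem exists_le_re_evansKappa (f : ℝ → ℝ) (c um up : ℝ) (hε : 0 < ε) :
    ∃ s R : ℝ, 0 < s ∧ 0 < R ∧ ∀ lam : ℂ, R ≤ ‖lam‖ → InEvansSector f c um up ε lam →
      s * √‖lam‖ ≤ (evansKappa f c um lam).re ∧ s * √‖lam‖ ≤ (evansKappa f c up lam).re := by
  -- For `ε ≥ π / 2` the sector is empty.
  rcases le_or_gt (Real.pi / 2) ε with hε' | hε'
  · refine ⟨1, 1, one_pos, one_pos, fun lam _ hs => absurd hs.1 (not_lt.2 ?_)⟩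
    exact (by linarith : Real.pi / 2 - ε ≤ 0).trans (abs_nonneg _)
  have hre : ∀ κ : ℂ, |κ.arg| < Real.pi / 2 - ε → Real.sin ε * ‖κ‖ ≤ κ.re := fun κ hκ => by
    rw [← Complex.norm_mul_cos_arg κ, mul_comm, ← Real.cos_pi_div_two_sub, ← Real.cos_abs κ.arg]
    refine mul_le_mul_of_nonneg_left (Real.cos_le_cos_of_nonneg_of_le_pi (abs_nonneg _) ?_ hκ.le)
      (norm_nonneg _)
    linarith [Real.pi_pos]
  have hsin : 0 < Real.sin ε := Real.sin_pos_of_pos_of_lt_pi hε (by linarith [Real.pi_pos])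
  refine ⟨Real.sin ε, c ^ 2 + 4 * |deriv f um| + 4 * |deriv f up| + 1, hsin, by positivity,
    fun lam hlam hs => ?_⟩
  have hc := sq_nonneg c
  have h1 := abs_nonneg (deriv f um)
  have h2 := abs_nonneg (deriv f up)
  have hroot : ∀ u, c ^ 2 + 4 * |deriv f u| ≤ 3 * ‖lam‖ → √‖lam‖ ≤ ‖evansKappa f c u lam‖ :=
    fun u hu => Real.sqrt_le_iff.2 ⟨norm_nonneg _, norm_le_norm_evansKappa_sq hu⟩
  exact ⟨(mul_le_mul_of_nonneg_left (hroot um (by linarith)) hsin.le).trans (hre _ hs.1),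
    (mul_le_mul_of_nonneg_left (hroot up (by linarith)) hsin.le).trans (hre _ hs.2)⟩

end Sector

end

/-! ### The main theorem -/

theorem mainTheorem2 (f : ℝ → ℝ) (hf : ContDiff ℝ ∞ f) (c um up : ℝ) (uh : ℝ → ℝ)
    (hwave : IsTravellingWave f c um up uh)
    (α : ℝ) (hα : 0 < α)
    (hleft : (fun ξ => wavePotential f uh ξ - deriv f um) =O[atBot] fun ξ => Real.exp (α * ξ))
    (hright : (fun ξ => wavePotential f uh ξ - deriv f up) =O[atTop] fun ξ => Real.exp (-(α * ξ)))
    (ε : ℝ) (hε : 0 < ε) (K : ℝ) (hK : 0 < K) :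
    ∃ R : ℝ, 0 < R ∧
      (∀ lam : ℂ, R ≤ ‖lam‖ → InEvansSector f c um up ε lam →
        (∃! y, IsLeftEvansSolution f c um uh lam y) ∧
        (∃! y, IsRightEvansSolution f c up uh lam y)) ∧
      (∃ C : ℝ, ∀ lam : ℂ, R ≤ ‖lam‖ → InEvansSector f c um up ε lam →
        ∀ (h : ℝ) (N : ℕ), 0 < h → StepNotSmall f c um up K lam h →
          ‖evansNumerical f c um up uh lam h N - evansFunction f c um up uh lam
              - (midpointQuadError (wavePotential f uh) h N : ℂ)‖
            ≤ C * (‖lam‖ ^ (-(1 / 2) : ℝ) * h ^ 2)) ∧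
      (∀ m : ℕ, ∃ C β : ℝ, 0 < β ∧
        ∀ lam : ℂ, R ≤ ‖lam‖ → InEvansSector f c um up ε lam →
        ∀ (h : ℝ) (N : ℕ), 0 < h → StepNotSmall f c um up K lam h →
          ‖evansNumerical f c um up uh lam h N - evansFunction f c um up uh lam‖
            ≤ C * (h ^ 2 * Real.exp (-(β * (N * h))) + h ^ (2 * m + 2)
                + ‖lam‖ ^ (-(1 / 2) : ℝ) * h ^ 2)) ∧
      (∀ m : ℕ, ∃ C : ℝ, ∀ lam : ℂ, R ≤ ‖lam‖ → InEvansSector f c um up ε lam →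
        ∃ L₀ : ℝ, ∀ (h : ℝ) (N : ℕ), 0 < h → StepNotSmall f c um up K lam h →
          L₀ ≤ N * h → h ^ (2 * m) ≤ ‖lam‖ ^ (-(1 / 2) : ℝ) →
          ‖evansNumerical f c um up uh lam h N - evansFunction f c um up uh lam‖
            ≤ C * (‖lam‖ ^ (-(1 / 2) : ℝ) * h ^ 2)) := by
  have hbdd := hwave.bddDeriv_wavePotential hf
  have hjet := BddDeriv.isJet hbdd
  obtain ⟨B, hφ⟩ := exists_twoSidedDecay hα (hbdd 0).1 (hbdd 0).2 hleft hright
  have hB := hφ.pos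
  have hβ := hφ.rate_pos
  have hdecay : JetDecay fun k => iteratedDeriv k (wavePotential f uh) := by
    refine hjet.jetDecay (lm := deriv f um) (lp := deriv f up) (B := B) (β := 2 * (α / 2))
      (by linarith) (fun k => ?_) (fun x hx => ?_) (fun x hx => ?_)
    · exact (BddDeriv.iteratedDeriv k (hbdd (0 + k))).bound
    · simpa using hφ.right.decay x hx
    · simpa using hφ.left.decay (-x) (by linarith)
  obtain ⟨C₁, γ₁, hγ₁, hC₁⟩ := hdecay 0
  obtain ⟨C₂, γ₂, hγ₂, hC₂⟩ := hdecay 1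
  have hweak : ∀ {C γ γ' x t : ℝ}, 0 ≤ C → γ' ≤ γ → |t| ≤ C * Real.exp (-γ * |x|) →
      ∀ C', C ≤ C' → |t| ≤ C' * Real.exp (-γ' * |x|) := by
    intro C γ γ' x t hC hγ ht C' hCC'
    refine ht.trans (mul_le_mul hCC' (Real.exp_le_exp.2 ?_) (Real.exp_pos _).le (hC.trans hCC'))
    nlinarith [abs_nonneg x]
  have hC₁0 : 0 ≤ C₁ := by
    have := (abs_nonneg _).trans (hC₁ 0)
    simpa using this
  have hC₂0 : 0 ≤ C₂ := by
    have := (abs_nonneg _).trans (hC₂ 0)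
    simpa using this
  have hjet0 : ∀ x, HasDerivAt (wavePotential f uh) (iteratedDeriv 1 (wavePotential f uh) x) x := by
    simpa using hjet 0
  obtain ⟨M, hM, hmain⟩ := exists_norm_evansNumerical_sub_le (c := c) (C := max C₁ C₂) hφ
    (lt_min hγ₁ hγ₂) hjet0 (hjet 1)
    (fun x => hweak hC₁0 (min_le_left _ _) (hC₁ x) _ (le_max_left _ _))
    (fun x => hweak hC₂0 (min_le_right _ _) (hC₂ x) _ (le_max_right _ _))
  obtain ⟨s, R, hs, hR, hre⟩ := exists_le_re_evansKappa f c um up hε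
  set T := 2 * B * expMass (α / 2) with hT_def
  have hT : 0 ≤ T := mul_nonneg (by positivity) (expMass_nonneg _)
  -- `S₀` exceeds each threshold required of `S = s √|lam|`; as `S₀ ≥ 1`, it also gives `8 B ≤ S ≤ S
  -- ^ 2`. The radius `(S₀ / s) ^ 2` is where `S` reaches `S₀`.
  set S₀ := 1 + 8 * B + 4 * T + 12 * B / (α / 2) with hS₀_def
  have hBα : 0 ≤ 12 * B / (α / 2) := by positivity
  have hS₀ : 1 ≤ S₀ := by linarith
  have hlarge : ∀ lam : ℂ, max R ((S₀ / s) ^ 2) ≤ ‖lam‖ → InEvansSector f c um up ε lam →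
      S₀ ≤ s * √‖lam‖ ∧ s * √‖lam‖ ≤ (evansKappa f c um lam).re ∧
        s * √‖lam‖ ≤ (evansKappa f c up lam).re := by
    intro lam hlam hsec
    refine ⟨?_, hre lam ((le_max_left _ _).trans hlam) hsec⟩
    have h1 := Real.le_sqrt_of_sq_le ((le_max_right _ _).trans hlam)
    rw [div_le_iff₀ hs] at h1
    linarith
  have hpos : ∀ lam : ℂ, max R ((S₀ / s) ^ 2) ≤ ‖lam‖ → 0 < ‖lam‖ := fun lam hlam =>
    hR.trans_le ((le_max_left _ _).trans hlam)
  have hrpow : ∀ lam : ℂ, ‖lam‖ ^ (-(1 / 2) : ℝ) = (√‖lam‖)⁻¹ := fun lam => by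
    rw [Real.rpow_neg (norm_nonneg _), Real.sqrt_eq_rpow]
  have hsq : ∀ S, S₀ ≤ S → 8 * B ≤ S ^ 2 := fun S hS => by nlinarith
  have hpart1 : ∀ lam : ℂ, max R ((S₀ / s) ^ 2) ≤ ‖lam‖ → InEvansSector f c um up ε lam →
      ∀ (h : ℝ) (N : ℕ), 0 < h →
        ‖evansNumerical f c um up uh lam h N - evansFunction f c um up uh lam
            - (midpointQuadError (wavePotential f uh) h N : ℂ)‖
          ≤ M / s * (‖lam‖ ^ (-(1 / 2) : ℝ) * h ^ 2) := by
    intro lam hlam hsec h N hh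
    obtain ⟨h1, h2, h3⟩ := hlarge lam hlam hsec
    refine (hmain _ lam h N (hS₀.trans h1) (hsq _ h1) (by linarith) (by linarith) h2 h3 hh).trans
      (le_of_eq ?_)
    rw [hrpow, ← div_div, div_eq_mul_inv (M / s), mul_assoc]
  have hpart2 : ∀ m : ℕ, ∃ C β : ℝ, 0 < β ∧
      ∀ lam : ℂ, max R ((S₀ / s) ^ 2) ≤ ‖lam‖ → InEvansSector f c um up ε lam →
      ∀ (h : ℝ) (N : ℕ), 0 < h → StepNotSmall f c um up K lam h →
        ‖evansNumerical f c um up uh lam h N - evansFunction f c um up uh lam‖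
          ≤ C * (h ^ 2 * Real.exp (-(β * (N * h))) + h ^ (2 * m + 2)
              + ‖lam‖ ^ (-(1 / 2) : ℝ) * h ^ 2) := by
    intro m
    obtain ⟨C, β, hC, hβ', hQ⟩ := hjet.quadSmall_midpointQuadError m hdecay
    -- `T` covers `h > 1`, where the uniform bound on the quadrature error is dominated by `T h ^ (2
    -- m + 2)`.
    refine ⟨M / s + C + T, β, hβ', fun lam hlam hsec h N hh _ => ?_⟩
    have h1 := hpart1 lam hlam hsec h N hh
    have h2 : |midpointQuadError (wavePotential f uh) h N|
        ≤ (C + T) * (h ^ 2 * Real.exp (-(β * (N * h))) + h ^ (2 * m + 2)) := by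
      have he : 0 ≤ h ^ 2 * Real.exp (-(β * (N * h))) := by positivity
      rcases le_or_gt h 1 with hh1 | hh1
      · have := hQ h N hh hh1
        simp only [iteratedDeriv_zero] at this
        refine this.trans (mul_le_mul_of_nonneg_right (by linarith) (by positivity))
      · refine (abs_midpointQuadError_le hφ hh N).trans ?_
        rw [← hT_def]
        have h3 : 1 ≤ h ^ (2 * m + 2) := one_le_pow₀ hh1.le
        nlinarith [mul_nonneg hT he, mul_nonneg hC he, mul_nonneg hC (zero_le_one.trans h3),
          mul_le_mul_of_nonneg_left h3 hT]
    have h3 := norm_add_le (evansNumerical f c um up uh lam h N - evansFunction f c um up uh lam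
      - (midpointQuadError (wavePotential f uh) h N : ℂ))
      (midpointQuadError (wavePotential f uh) h N : ℂ)
    rw [sub_add_cancel, Complex.norm_real, Real.norm_eq_abs] at h3
    have h4 : 0 ≤ h ^ 2 * Real.exp (-(β * (N * h))) + h ^ (2 * m + 2) := by positivity
    have h5 : 0 ≤ ‖lam‖ ^ (-(1 / 2) : ℝ) * h ^ 2 := by positivity
    have h6 : 0 ≤ M / s := by positivity
    linarith [mul_nonneg h6 h4, mul_nonneg (add_nonneg hC hT) h5]
  refine ⟨max R ((S₀ / s) ^ 2), hR.trans_le (le_max_left _ _), ?_, ⟨M / s, ?_⟩, hpart2, ?_⟩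
  · intro lam hlam hsec
    obtain ⟨h1, h2, h3⟩ := hlarge lam hlam hsec
    have hS : 0 < s * √‖lam‖ := by linarith
    exact ⟨hφ.existsUnique_left hS (hsq _ h1) h2, hφ.existsUnique_right hS (hsq _ h1) h3⟩
  · exact fun lam hlam hsec h N hh _ => hpart1 lam hlam hsec h N hh
  · intro m
    obtain ⟨C, β, hβ', hC⟩ := hpart2 m
    -- `L₀` is where `exp (-β L)` falls to `|lam| ^ (-1 / 2)`. Each of the three terms of part 2 is
    -- then at most `|lam| ^ (-1 / 2) h ^ 2`; the absolute value is taken since part 2 gives no sign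
    -- for `C`.
    refine ⟨3 * |C|, fun lam hlam hsec => ⟨Real.log (√‖lam‖) / β, fun h N hh hstep hL hm => ?_⟩⟩
    have h1 := hC lam hlam hsec h N hh hstep
    have hsqrt : 0 < √‖lam‖ := Real.sqrt_pos.2 (hpos lam hlam)
    have h2 : Real.exp (-(β * (N * h))) ≤ ‖lam‖ ^ (-(1 / 2) : ℝ) := by
      rw [hrpow, ← Real.exp_log hsqrt, ← Real.exp_neg, Real.exp_le_exp]
      rw [div_le_iff₀ hβ'] at hL
      linarith
    have h3 : h ^ (2 * m + 2) ≤ ‖lam‖ ^ (-(1 / 2) : ℝ) * h ^ 2 := by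
      rw [pow_add]
      exact mul_le_mul_of_nonneg_right hm (sq_nonneg h)
    have h4 : h ^ 2 * Real.exp (-(β * (N * h))) ≤ ‖lam‖ ^ (-(1 / 2) : ℝ) * h ^ 2 := by
      rw [mul_comm]
      exact mul_le_mul_of_nonneg_right h2 (sq_nonneg h)
    refine h1.trans ((mul_le_mul_of_nonneg_right (le_abs_self C) (by positivity)).trans ?_)
    rw [mul_comm 3, mul_assoc]
    exact mul_le_mul_of_nonneg_left (by linarith) (abs_nonneg C)
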